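/- Let $R\subset\mathbb{R}^2$ be a bounded convex region, that is, a bounded convex set with nonempty interior. For each $n$ let $R_n$ be a set of $n$ points chosen independently and uniformly at random from $R$. A convex hole (empty convex polygon) of a finite point set $P\subset\mathbb{R}^2$ is a convex polygon whose vertices belong to $P$ and whose interior contains no point of $P$. Let $\mathrm{Hol}(R_n)$ denote the random variable that measures the number of vertices of the largest convex hole of $R_n$ (with value $0$ if there is none). Then, as $n\to\infty$, $$ \mathbb{E}\bigl(\mathrm{Hol}(R_n)\bigr)=\Theta\left(\frac{\log n}{\log\log n}\right). $$ Moreover, with high probability $\mathrm{Hol}(R_n)=\Theta\left(\frac{\log n}{\log\log n}\right)$; that is, there are constants $c,C>0$ such that $$ \Pr\left(c\,\frac{\log n}{\log\log n}\le \mathrm{Hol}(R_n)\le C\,\frac{\log n}{\log\log n}\right)\longrightarrow 1\qquad\text{as } n\to\infty . $$ Here $\log$ is the natural logarithm. -/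

import Mathlib

open MeasureTheory Filter Topology Asymptotics

/-- The Euclidean plane. -/
abbrev Plane : Type := EuclideanSpace ℝ (Fin 2)

/-- `V` is the vertex set of a convex hole (empty convex polygon) of the finite point set `P`:
`V ⊆ P`, the set `V` has at least three points and is in convex position (so the polygon
`convexHull ℝ V` has vertex set exactly `V`), and no point of `P` lies in the interior of that
polygon. -/
def IsConvexHole (P V : Finset Plane) : Prop :=
  V ⊆ P ∧ 3 ≤ V.card ∧
    ConvexIndependent ℝ (Subtype.val : {v : Plane // v ∈ V} → Plane) ∧
    ∀ p ∈ P, p ∉ interior (convexHull ℝ (V : Set Plane))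

open Classical in
/-- The number of vertices of the largest convex hole of `P`
(which is `0` if `P` has no convex hole). -/
noncomputable def hol (P : Finset Plane) : ℕ :=
  (P.powerset.filter (fun V => IsConvexHole P V)).sup Finset.card

open Classical in
/-- The set of the points of a finite sequence `x`. -/
noncomputable def pointSet {n : ℕ} (x : Fin n → Plane) : Finset Plane :=
  Finset.univ.image x

/-- The joint law of `n` independent points, each uniformly distributed in `R`: the product of
`n` copies of the normalized restriction of the area measure to `R`. -/
noncomputable def uniformPoints (R : Set Plane) (n : ℕ) : Measure (Fin n → Plane) :=
  Measure.pi (fun _ : Fin n => ProbabilityTheory.cond (volume : Measure Plane) R)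

/-! ### Measurability of the size of the largest hole -/

/-! Upper bound. Among the vertices of a large hole take a triangle `a b c` of maximal area
(`exists_max_frame`). In its affine coordinates all vertices lie in `[-1, 1]²`, while the cell `(0,
1/2)²` lies inside the triangle and so contains no sample point. Convex position gives every vertex
a quadrant free of other vertices (`exists_free_quadrant`). By pigeonhole over the four quadrants, a
hole with `4m + 3` vertices contains, besides `a, b, c`, a chain of `m` vertices monotone in both
coordinates (`exists_frameChainEvent`).

Fix the labels of the frame and the chain, and let `x` be the probability of the cell. The square
has area 16 times that of the cell, so the chain has probability at most `2 (16 x)^m / m!²`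
(`pi_squareChains_le`), and the other `r` points avoid the cell with probability `(1 - x)^r`. Since
`x^m (1 - x)^r ≤ m! / r^m`, the size of the triangle drops out. A union bound over at most `n^(3+m)`
labellings leaves `2 n³ 32^m / m!` (`uniformPoints_hol_ge_le`), which is tiny once `m` is a large
multiple of `log n / log log n`.

Lower bound. Cut a square inside `R` into about `n` boxes, each with a bounded expected number of
points, and place `k` small cells along a parabola in each box. If a box contains exactly `k`
points, one per cell, these span a hole (`le_hol_of_occupied`). The expected number of such boxes is
at least about `n (c / k⁴)^k`, which tends to infinity for `k` a small multiple of `log n / log log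
n`. Distinct boxes are almost independent, so a second moment argument (`real_not_occupied_le`)
makes such a box likely.

The expectation follows: the upper tail is `O(n⁻³)` while the hole has at most `n` vertices, and
Markov's inequality gives the other direction. -/

theorem le_hol_iff {P : Finset Plane} {k : ℕ} (hk : 0 < k) :
    k ≤ hol P ↔ ∃ V, IsConvexHole P V ∧ k ≤ V.card := by
  classical
  unfold hol
  rw [Finset.le_sup_iff (by simpa using hk)]
  constructor
  · rintro ⟨V, hV, h⟩
    exact ⟨V, (Finset.mem_filter.1 hV).2, h⟩
  · rintro ⟨V, hV, h⟩
    exact ⟨V, Finset.mem_filter.2 ⟨Finset.mem_powerset.2 hV.1, hV⟩, h⟩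

theorem hol_pointSet_le {n : ℕ} (x : Fin n → Plane) : hol (pointSet x) ≤ n := by
  classical
  unfold hol
  refine Finset.sup_le fun V hV => ?_
  have h1 := Finset.card_le_card (Finset.mem_filter.1 hV).2.1
  have h2 : (pointSet x).card ≤ (Finset.univ : Finset (Fin n)).card := by
    unfold pointSet; exact Finset.card_image_le
  simp at h2
  omega

theorem convexHull_image_eq_linearCombination {ι E : Type*} [Fintype ι] [DecidableEq ι]
    [AddCommGroup E] [Module ℝ E] (x : ι → E) (T : Set ι) :
    convexHull ℝ (x '' T) =
      Fintype.linearCombination ℝ x ''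
        convexHull ℝ ((fun j => (Pi.single j 1 : ι → ℝ)) '' T) := by
  rw [LinearMap.image_convexHull, Set.image_image]
  congr 1
  refine Set.image_congr fun j _ => ?_
  simp

/-- Membership means that some weight vector in a compact simplex solves an equation continuous in
weights and points; projecting a closed set along a compact factor keeps it closed. The shift `v`
serves to describe interiors. -/
theorem isClosed_add_mem_convexHull {ι : Type*} [Fintype ι] (i : ι) (v : Plane) (T : Set ι) :
    IsClosed {x : ι → Plane | x i + v ∈ convexHull ℝ (x '' T)} := by
  classical
  set K := convexHull ℝ ((fun j => (Pi.single j 1 : ι → ℝ)) '' T) with hK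
  have hKc : IsCompact K := ((Set.toFinite T).image _).isCompact_convexHull (𝕜 := ℝ)
  have : CompactSpace K := isCompact_iff_compactSpace.1 hKc
  have hcl : IsClosed {p : K × (ι → Plane) | ∑ j, (p.1 : ι → ℝ) j • p.2 j = p.2 i + v} := by
    apply isClosed_eq
    · refine continuous_finsetSum _ fun j _ => ?_
      have h1 : Continuous fun p : K × (ι → Plane) => (p.1 : ι → ℝ) j :=
        (continuous_apply j).comp (continuous_subtype_val.comp continuous_fst)
      exact h1.smul ((continuous_apply j).comp continuous_snd)
    · exact ((continuous_apply i).comp continuous_snd).add continuous_const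
  convert isClosedMap_snd_of_compactSpace _ hcl using 1
  ext x
  simp only [Set.mem_ofPred_eq, Set.mem_image, Prod.exists, exists_eq_right]
  rw [convexHull_image_eq_linearCombination]
  constructor
  · rintro ⟨w, hw, h⟩
    exact ⟨⟨w, hw⟩, by simpa [Fintype.linearCombination_apply] using h⟩
  · rintro ⟨w, h⟩
    exact ⟨w, w.2, by simpa [Fintype.linearCombination_apply] using h⟩

theorem measurableSet_mem_interior_convexHull {ι : Type*} [Fintype ι] (i : ι) (T : Set ι) :
    MeasurableSet {x : ι → Plane | x i ∈ interior (convexHull ℝ (x '' T))} := by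
  have : {x : ι → Plane | x i ∈ interior (convexHull ℝ (x '' T))} =
      -- The intersection is uncountable but each set in it is closed, so only the union over radii
      -- has to be countable.
      ⋃ k : ℕ, ⋂ v ∈ Metric.ball (0 : Plane) (1 / ((k : ℝ) + 1)),
        {x : ι → Plane | x i + v ∈ convexHull ℝ (x '' T)} := by
    ext x
    simp only [Set.mem_ofPred_eq, Set.mem_iUnion, Set.mem_iInter, mem_interior_iff_mem_nhds,
      Metric.mem_nhds_iff]
    constructor
    · rintro ⟨ε, hε, h⟩
      obtain ⟨k, hk⟩ := exists_nat_one_div_lt hε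
      refine ⟨k, fun v hv => h ?_⟩
      simp only [Metric.mem_ball, dist_zero_right, dist_self_add_left] at hv ⊢
      linarith
    · rintro ⟨k, h⟩
      refine ⟨1 / ((k : ℝ) + 1), by positivity, fun y hy => ?_⟩
      have := h (y - x i) (by simpa [dist_eq_norm] using hy)
      simpa using this
  rw [this]
  refine MeasurableSet.iUnion fun k => IsClosed.measurableSet ?_
  exact isClosed_biInter fun v _ => isClosed_add_mem_convexHull i v T

/-- Index sets do not depend on `x`, so the event becomes a finite union of measurable conditions.
Coinciding sample points do no harm: the hull condition forces `x` to be injective on `S`. -/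
theorem exists_isConvexHole_pointSet_iff {n : ℕ} (x : Fin n → Plane) (k : ℕ) :
    (∃ V, IsConvexHole (pointSet x) V ∧ k ≤ V.card) ↔
      ∃ S : Finset (Fin n), (3 ≤ S.card ∧ k ≤ S.card) ∧
        (∀ i ∈ S, x i ∉ convexHull ℝ (x '' (S \ {i} : Set (Fin n)))) ∧
        ∀ i, x i ∉ interior (convexHull ℝ (x '' S)) := by
  classical
  constructor
  · rintro ⟨V, ⟨hVP, h3, hci, hint⟩, hk⟩
    have hs : (V : Set Plane) ⊆ x '' Set.univ := by
      intro v hv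
      obtain ⟨i, -, hi⟩ := Finset.mem_image.1 (hVP hv)
      exact ⟨i, trivial, hi⟩
    obtain ⟨S, -, hSinj, hSV⟩ :=
      Finset.exists_subset_injOn_image_eq_of_surjOn (f := x) Set.univ V hs
    have hcard : S.card = V.card := by rw [← hSV, Finset.card_image_of_injOn hSinj]
    have hSV' : x '' (S : Set (Fin n)) = V := by rw [← hSV]; simp
    refine ⟨S, ⟨by omega, by omega⟩, ?_, ?_⟩
    · intro i hi
      have := (convexIndependent_set_iff_notMem_convexHull_sdiff (s := (V : Set Plane))).1 hci (x i)
        (by rw [← hSV']; exact ⟨i, hi, rfl⟩)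
      refine fun h => this (convexHull_mono ?_ h)
      rintro _ ⟨j, ⟨hj, hji⟩, rfl⟩
      refine ⟨by rw [← hSV']; exact ⟨j, hj, rfl⟩, fun e => hji (hSinj hj hi e)⟩
    · intro i
      rw [hSV']
      exact hint _ (by simp [pointSet])
  · rintro ⟨S, ⟨h3, hk⟩, hci, hint⟩
    have hinj : Set.InjOn x S := by
      intro i hi j hj e
      by_contra hne
      refine hci i hi (subset_convexHull _ _ ?_)
      exact ⟨j, ⟨hj, fun h => hne h.symm⟩, e.symm⟩
    have hcard : (S.image x).card = S.card := Finset.card_image_of_injOn hinj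
    refine ⟨S.image x, ⟨?_, by omega, ?_, ?_⟩, by omega⟩
    · intro v hv
      obtain ⟨i, -, rfl⟩ := Finset.mem_image.1 hv
      simp [pointSet]
    · refine (convexIndependent_set_iff_notMem_convexHull_sdiff
        (s := ((S.image x : Finset Plane) : Set Plane))).2 ?_
      intro v hv h
      obtain ⟨i, hi, rfl⟩ := Finset.mem_image.1 hv
      refine hci i hi (convexHull_mono ?_ h)
      rintro w ⟨hw, hne⟩
      obtain ⟨j, hj, rfl⟩ := Finset.mem_image.1 hw
      exact ⟨j, ⟨hj, fun h => hne (by rw [Set.mem_singleton_iff] at h; simp [h])⟩, rfl⟩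
    · intro p hp
      obtain ⟨i, -, rfl⟩ := Finset.mem_image.1 hp
      simpa using hint i

theorem measurable_hol_pointSet (n : ℕ) :
    Measurable fun x : Fin n → Plane => hol (pointSet x) := by
  refine measurable_of_Ici fun k => ?_
  rcases Nat.eq_zero_or_pos k with rfl | hk
  · simp
  have : (fun x : Fin n → Plane => hol (pointSet x)) ⁻¹' Set.Ici k =
      ⋃ S : Finset (Fin n), ⋃ _ : 3 ≤ S.card ∧ k ≤ S.card,
        ((⋂ i ∈ S, {x | x i + 0 ∈ convexHull ℝ (x '' (S \ {i} : Set (Fin n)))}ᶜ) ∩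
          ⋂ i, {x | x i ∈ interior (convexHull ℝ (x '' S))}ᶜ) := by
    ext x
    simp only [Set.mem_preimage, Set.mem_Ici]
    rw [le_hol_iff hk, exists_isConvexHole_pointSet_iff x]
    simp only [Set.mem_iUnion, Set.mem_inter_iff, Set.mem_iInter, Set.mem_compl_iff,
      Set.mem_ofPred_eq, add_zero, exists_prop]
  rw [this]
  refine MeasurableSet.iUnion fun S => MeasurableSet.iUnion fun _ => MeasurableSet.inter ?_ ?_
  · exact Finset.measurableSet_biInter _ fun i _ =>
      (isClosed_add_mem_convexHull i 0 _).measurableSet.compl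
  · exact MeasurableSet.iInter fun i => (measurableSet_mem_interior_convexHull i _).compl

/-! ### Monotone chains in product measures -/

theorem MeasureTheory.Measure.pi_le_pi {ι : Type*} [Fintype ι] {α : ι → Type*}
    [∀ i, MeasurableSpace (α i)] {μ ν : ∀ i, Measure (α i)} (h : ∀ i, μ i ≤ ν i) :
    Measure.pi μ ≤ Measure.pi ν := by
  have key : OuterMeasure.pi (fun i => (μ i).toOuterMeasure) ≤
      OuterMeasure.pi fun i => (ν i).toOuterMeasure := by
    rw [OuterMeasure.le_pi]
    intro s _
    refine (OuterMeasure.pi_pi_le _ s).trans ?_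
    exact Finset.prod_le_prod' fun i _ => h i (s i)
  refine Measure.le_iff.2 fun s hs => ?_
  rw [Measure.pi_def, Measure.pi_def, toMeasure_apply _ _ hs, toMeasure_apply _ _ hs]
  exact key s

theorem measurableSet_strictMono (m : ℕ) : MeasurableSet {u : Fin m → ℝ | StrictMono u} := by
  have : {u : Fin m → ℝ | StrictMono u} = ⋂ i, ⋂ j, ⋂ _ : i < j, {u | u i < u j} := by
    ext u; simp [StrictMono]
  rw [this]
  exact MeasurableSet.iInter fun i => MeasurableSet.iInter fun j => MeasurableSet.iInter fun _ =>
    measurableSet_lt (measurable_pi_apply i) (measurable_pi_apply j)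

theorem measurableSet_strictAnti (m : ℕ) : MeasurableSet {u : Fin m → ℝ | StrictAnti u} := by
  have : {u : Fin m → ℝ | StrictAnti u} = ⋂ i, ⋂ j, ⋂ _ : i < j, {u | u j < u i} := by
    ext u; simp [StrictAnti]
  rw [this]
  exact MeasurableSet.iInter fun i => MeasurableSet.iInter fun j => MeasurableSet.iInter fun _ =>
    measurableSet_lt (measurable_pi_apply j) (measurable_pi_apply i)

theorem pi_preimage_comp_equiv {ι ι' X : Type*} [Fintype ι] [Fintype ι'] [MeasurableSpace X]
    (α : Measure X) [SigmaFinite α] (e : ι ≃ ι') {s : Set (ι → X)} (hs : MeasurableSet s) :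
    Measure.pi (fun _ : ι' => α) {u : ι' → X | u ∘ e ∈ s} = Measure.pi (fun _ => α) s := by
  have h := measurePreserving_arrowCongr' (fun _ : ι' => α) (fun _ : ι => α) e.symm
    (MeasurableEquiv.refl X) fun _ => MeasurePreserving.id _
  rw [← h.measure_preimage hs.nullMeasurableSet]
  rfl

/-- The `m!` orderings of the coordinates are disjoint events of equal measure. -/
theorem factorial_mul_pi_strictMono_le (α : Measure ℝ) [IsFiniteMeasure α] (m : ℕ) :
    (m.factorial : ENNReal) * Measure.pi (fun _ => α) {u : Fin m → ℝ | StrictMono u} ≤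
      α Set.univ ^ m := by
  have hd : Pairwise (Function.onFun Disjoint
      fun σ : Equiv.Perm (Fin m) => {u : Fin m → ℝ | StrictMono (u ∘ σ)}) := by
    intro σ τ hne
    rw [Function.onFun, Set.disjoint_left]
    intro u h1 h2
    apply hne
    have hr : Set.range (u ∘ σ) = Set.range (u ∘ τ) := by
      rw [Set.range_comp, Set.range_comp]; simp
    have := StrictMono.range_inj (f := u ∘ σ) (g := u ∘ τ) h1 h2 |>.1 hr
    have hinj : Function.Injective u := by
      have h3 : Function.Injective (u ∘ σ) := StrictMono.injective h1
      intro i j e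
      have := @h3 (σ.symm i) (σ.symm j) (by simpa using e)
      simpa using this
    ext i
    have := congrFun this i
    exact congrArg _ (hinj this)
  have hm : ∀ σ : Equiv.Perm (Fin m), MeasurableSet {u : Fin m → ℝ | StrictMono (u ∘ σ)} := by
    intro σ
    exact (measurableSet_strictMono m).preimage
      (measurable_pi_lambda _ fun i => measurable_pi_apply (σ i))
  calc (m.factorial : ENNReal) * Measure.pi (fun _ => α) {u : Fin m → ℝ | StrictMono u}
      = ∑ σ : Equiv.Perm (Fin m),
          Measure.pi (fun _ => α) {u : Fin m → ℝ | StrictMono (u ∘ σ)} := by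
        have h (σ : Equiv.Perm (Fin m)) :
            Measure.pi (fun _ => α) {u : Fin m → ℝ | StrictMono (u ∘ σ)} =
              Measure.pi (fun _ => α) {u : Fin m → ℝ | StrictMono u} :=
          pi_preimage_comp_equiv α σ (measurableSet_strictMono m)
        simp [h, Fintype.card_perm]
    _ = Measure.pi (fun _ => α) (⋃ σ : Equiv.Perm (Fin m),
          {u : Fin m → ℝ | StrictMono (u ∘ σ)}) := by
        rw [measure_iUnion hd hm, tsum_fintype]
    _ ≤ Measure.pi (fun _ : Fin m => α) Set.univ := measure_mono (Set.subset_univ _)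
    _ = α Set.univ ^ m := by simp [Measure.pi_univ]

theorem factorial_mul_pi_strictAnti_le (α : Measure ℝ) [IsFiniteMeasure α] (m : ℕ) :
    (m.factorial : ENNReal) * Measure.pi (fun _ => α) {u : Fin m → ℝ | StrictAnti u} ≤
      α Set.univ ^ m := by
  refine le_of_eq_of_le ?_ (factorial_mul_pi_strictMono_le α m)
  rw [← pi_preimage_comp_equiv α Fin.revPerm (measurableSet_strictAnti m)]
  congr 2
  ext u
  simp only [Set.mem_ofPred_eq]
  constructor
  · intro h i j hij
    have := h (Fin.rev_lt_rev.2 hij)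
    simpa using this
  · intro h i j hij
    exact h (Fin.rev_lt_rev.2 hij)

/-- Sequences of points of the square `[-1, 1]²` that are monotone in both coordinates. -/
def squareChains (m : ℕ) : Set (Fin m → ℝ × ℝ) :=
  {w | (∀ l, w l ∈ Set.Icc (-1 : ℝ) 1 ×ˢ Set.Icc (-1 : ℝ) 1) ∧
    StrictMono (fun l => (w l).1) ∧
      (StrictMono (fun l => (w l).2) ∨ StrictAnti fun l => (w l).2)}

theorem measurableSet_squareChains (m : ℕ) : MeasurableSet (squareChains m) := by
  have h1 : Measurable fun (w : Fin m → ℝ × ℝ) l => (w l).1 := by fun_prop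
  have h2 : Measurable fun (w : Fin m → ℝ × ℝ) l => (w l).2 := by fun_prop
  have h0 : MeasurableSet {w : Fin m → ℝ × ℝ |
      ∀ l, w l ∈ Set.Icc (-1 : ℝ) 1 ×ˢ Set.Icc (-1 : ℝ) 1} := by
    simp only [Set.ofPred_forall]
    exact MeasurableSet.iInter fun l =>
      (measurableSet_Icc.prod measurableSet_Icc).preimage (measurable_pi_apply l)
  exact h0.inter ((measurableSet_strictMono m |>.preimage h1).inter
    ((measurableSet_strictMono m |>.preimage h2).union
      (measurableSet_strictAnti m |>.preimage h2)))

/-- Domination by a product measure on the square, with the whole density `κ` put into the first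
factor, decouples the two coordinates. Each ordering then costs a factor `1 / m!`, and the leading 2
counts the two directions of the second coordinate. -/
theorem pi_squareChains_le (ν : Measure (ℝ × ℝ)) [SigmaFinite ν] (κ : ENNReal) (hκ : κ ≠ ⊤)
    (hν : ν ≤ κ • volume) (m : ℕ) :
    (m.factorial : ENNReal) ^ 2 * Measure.pi (fun _ => ν) (squareChains m) ≤
      2 * (4 * κ) ^ m := by
  set I := Set.Icc (-1 : ℝ) 1 with hI
  set β : Measure ℝ := volume.restrict I with hβ
  set α : Measure ℝ := κ • β with hα
  have : IsFiniteMeasure β := ⟨by simp [hβ, hI]⟩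
  have : IsFiniteMeasure α := ⟨by
    rw [hα, Measure.smul_apply, smul_eq_mul]
    exact ENNReal.mul_lt_top hκ.lt_top (measure_lt_top _ _)⟩
  have hβu : β Set.univ = 2 := by
    simp [hβ, hI]; norm_num
  have hαu : α Set.univ = 2 * κ := by
    rw [hα, Measure.smul_apply, smul_eq_mul, hβu, mul_comm]
  have hsub : squareChains m ⊆ Set.univ.pi fun _ => I ×ˢ I := fun w hw l _ => hw.1 l
  have h1 : Measure.pi (fun _ => ν) (squareChains m) ≤
      Measure.pi (fun _ : Fin m => α.prod β) (squareChains m) := by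
    calc Measure.pi (fun _ => ν) (squareChains m)
        = (Measure.pi fun _ : Fin m => ν).restrict (Set.univ.pi fun _ => I ×ˢ I)
            (squareChains m) := by
          rw [Measure.restrict_apply (measurableSet_squareChains m),
            Set.inter_eq_left.2 hsub]
      _ = Measure.pi (fun _ : Fin m => ν.restrict (I ×ˢ I)) (squareChains m) := by
          rw [Measure.restrict_pi_pi]
      _ ≤ _ := by
          refine Measure.pi_le_pi (fun _ => ?_) _
          calc ν.restrict (I ×ˢ I) ≤ (κ • volume).restrict (I ×ˢ I) :=
                Measure.restrict_mono subset_rfl hν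
            _ = α.prod β := by
                rw [Measure.restrict_smul, hα, Measure.prod_smul_left, hβ, Measure.prod_restrict]
                rfl
  have h2 : Measure.pi (fun _ : Fin m => α.prod β) (squareChains m) ≤
      Measure.pi (fun _ : Fin m => α) {u | StrictMono u} *
        (Measure.pi (fun _ : Fin m => β) {u | StrictMono u} +
          Measure.pi (fun _ : Fin m => β) {u | StrictAnti u}) := by
    have hmp := measurePreserving_arrowProdEquivProdArrow ℝ ℝ (Fin m) (fun _ => α) (fun _ => β)
    have hm : MeasurableSet ({u : Fin m → ℝ | StrictMono u} ×ˢ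
        ({u : Fin m → ℝ | StrictMono u} ∪ {u | StrictAnti u})) :=
      (measurableSet_strictMono m).prod
        ((measurableSet_strictMono m).union (measurableSet_strictAnti m))
    calc Measure.pi (fun _ : Fin m => α.prod β) (squareChains m)
        ≤ Measure.pi (fun _ : Fin m => α.prod β)
          (MeasurableEquiv.arrowProdEquivProdArrow ℝ ℝ (Fin m) ⁻¹'
            ({u : Fin m → ℝ | StrictMono u} ×ˢ
              ({u : Fin m → ℝ | StrictMono u} ∪ {u | StrictAnti u}))) :=
          measure_mono fun w hw => ⟨hw.2.1, hw.2.2⟩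
      _ = _ := hmp.measure_preimage hm.nullMeasurableSet
      _ = _ := Measure.prod_prod _ _
      _ ≤ _ := by gcongr; exact measure_union_le _ _
  have a1 := factorial_mul_pi_strictMono_le α m
  have a2 := factorial_mul_pi_strictMono_le β m
  have a3 := factorial_mul_pi_strictAnti_le β m
  rw [hαu] at a1
  rw [hβu] at a2 a3
  calc (m.factorial : ENNReal) ^ 2 * Measure.pi (fun _ => ν) (squareChains m)
      ≤ (m.factorial : ENNReal) ^ 2 * (Measure.pi (fun _ : Fin m => α) {u | StrictMono u} *
        (Measure.pi (fun _ : Fin m => β) {u | StrictMono u} +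
          Measure.pi (fun _ : Fin m => β) {u | StrictAnti u})) := by
        gcongr; exact h1.trans h2
    _ = ((m.factorial : ENNReal) * Measure.pi (fun _ : Fin m => α) {u | StrictMono u}) *
        ((m.factorial : ENNReal) * Measure.pi (fun _ : Fin m => β) {u | StrictMono u} +
          (m.factorial : ENNReal) * Measure.pi (fun _ : Fin m => β) {u | StrictAnti u}) := by
        ring
    _ ≤ (2 * κ) ^ m * (2 ^ m + 2 ^ m) := by gcongr
    _ = 2 * (4 * κ) ^ m := by
        rw [← two_mul, mul_left_comm, ← mul_pow]
        ring_nf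

/-! ### Affine coordinates -/

/-- Twice the signed area of the triangle `a b c`. -/
def doubleArea (a b c : Plane) : ℝ :=
  (b 0 - a 0) * (c 1 - a 1) - (b 1 - a 1) * (c 0 - a 0)

/-- The coordinates with respect to the affine frame that has origin `a` and unit points `b`
and `c`. -/
noncomputable def frameCoords (a b c v : Plane) : ℝ × ℝ :=
  (doubleArea a v c / doubleArea a b c, doubleArea a b v / doubleArea a b c)

theorem measurable_frameCoords :
    Measurable fun p : (Plane × Plane × Plane) × Plane =>
      frameCoords p.1.1 p.1.2.1 p.1.2.2 p.2 := by
  unfold frameCoords doubleArea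
  fun_prop

/-- By Cramer's rule the frame coordinates are an affine map whose linear part has determinant `1 /
doubleArea a b c`. -/
theorem map_frameCoords_volume {a b c : Plane} (h : doubleArea a b c ≠ 0) :
    Measure.map (frameCoords a b c) volume =
      ENNReal.ofReal |doubleArea a b c| • (volume : Measure (ℝ × ℝ)) := by
  set D := doubleArea a b c with hD
  let M : Matrix (Fin 2) (Fin 2) ℝ :=
    !![(c 1 - a 1) / D, -(c 0 - a 0) / D; -(b 1 - a 1) / D, (b 0 - a 0) / D]
  have hM : M.det = D⁻¹ := by
    rw [Matrix.det_fin_two_of]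
    field_simp
    rw [hD, doubleArea]
    ring
  have e : frameCoords a b c =
      (MeasurableEquiv.finTwoArrow (α := ℝ)) ∘ (Matrix.toLin' M) ∘
        (fun v : Plane => WithLp.ofLp v) ∘ (fun v : Plane => v - a) := by
    funext v
    have e0 : frameCoords a b c v = (doubleArea a v c / D, doubleArea a b v / D) := rfl
    rw [e0]
    clear_value D
    ext
    · simp [doubleArea, M, Matrix.mulVec, dotProduct, Fin.sum_univ_two,
        MeasurableEquiv.finTwoArrow]
      ring
    · simp [doubleArea, M, Matrix.mulVec, dotProduct, Fin.sum_univ_two,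
        MeasurableEquiv.finTwoArrow]
      ring
  have m1 : Measurable fun v : Plane => v - a := by fun_prop
  have m2 : Measurable (fun v : Plane => WithLp.ofLp v) := by fun_prop
  have m3 : Measurable (Matrix.toLin' M) :=
    (LinearMap.continuous_of_finiteDimensional _).measurable
  have m4 := (MeasurableEquiv.finTwoArrow (α := ℝ)).measurable
  rw [e, ← Measure.map_map m4 (m3.comp (m2.comp m1)), ← Measure.map_map m3 (m2.comp m1),
    ← Measure.map_map m2 m1, (measurePreserving_sub_right volume a).map_eq,
    (PiLp.volume_preserving_ofLp (Fin 2)).map_eq,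
    Real.map_linearMap_volume_pi_eq_smul_volume_pi, Measure.map_smul,
    (volume_preserving_finTwoArrow ℝ).map_eq]
  · rw [LinearMap.det_toLin', hM, inv_inv]
  · rw [LinearMap.det_toLin', hM]
    exact inv_ne_zero h

/-! ### The uniform distribution on a convex region -/

section Region

variable {R : Set Plane}

theorem volume_ne_zero_of_interior (hint : (interior R).Nonempty) : volume R ≠ 0 :=
  (Measure.measure_pos_of_nonempty_interior _ hint).ne'

theorem isProbabilityMeasure_cond (hbdd : Bornology.IsBounded R)
    (hint : (interior R).Nonempty) :
    IsProbabilityMeasure (ProbabilityTheory.cond (volume : Measure Plane) R) :=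
  ProbabilityTheory.cond_isProbabilityMeasure_of_finite (volume_ne_zero_of_interior hint)
    hbdd.measure_lt_top.ne

theorem cond_le_smul_volume :
    ProbabilityTheory.cond (volume : Measure Plane) R ≤ (volume R)⁻¹ • volume := by
  refine Measure.le_iff.2 fun s hs => ?_
  rw [ProbabilityTheory.cond_apply' hs, Measure.smul_apply, smul_eq_mul]
  gcongr
  exact Set.inter_subset_right

theorem cond_apply_of_subset {s : Set Plane} (hs : MeasurableSet s) (h : s ⊆ R) :
    ProbabilityTheory.cond (volume : Measure Plane) R s = (volume R)⁻¹ * volume s := by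
  rw [ProbabilityTheory.cond_apply' hs, Set.inter_eq_right.2 h]

/-- The closure stands in for `R`, which is not assumed measurable; for a convex region both have
the same interior. -/
theorem ae_cond_mem_closure :
    ∀ᵐ v ∂ProbabilityTheory.cond (volume : Measure Plane) R, v ∈ closure R := by
  rw [ae_iff]
  have hm : MeasurableSet (closure R)ᶜ := isClosed_closure.measurableSet.compl
  change ProbabilityTheory.cond (volume : Measure Plane) R (closure R)ᶜ = 0
  rw [ProbabilityTheory.cond_apply' hm]
  have : R ∩ (closure R)ᶜ = ∅ := by
    ext v
    simp only [Set.mem_inter_iff, Set.mem_compl_iff, Set.mem_empty_iff_false, iff_false, not_and,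
      not_not]
    exact fun h => subset_closure h
  simp [this]

end Region

/-! ### The cell of a frame -/

/-- The parallelogram of the points with both frame coordinates in `(0, 1/2)`. -/
noncomputable def frameCell (a b c : Plane) : Set Plane :=
  frameCoords a b c ⁻¹' (Set.Ioo 0 (1 / 2) ×ˢ Set.Ioo 0 (1 / 2))

theorem continuous_frameCoords (a b c : Plane) : Continuous (frameCoords a b c) := by
  unfold frameCoords doubleArea
  fun_prop

theorem isOpen_frameCell (a b c : Plane) : IsOpen (frameCell a b c) :=
  (isOpen_Ioo.prod isOpen_Ioo).preimage (continuous_frameCoords a b c)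

theorem eq_frame_combination {a b c : Plane} (h : doubleArea a b c ≠ 0) (v : Plane) :
    (1 - (frameCoords a b c v).1 - (frameCoords a b c v).2) • a +
      (frameCoords a b c v).1 • b + (frameCoords a b c v).2 • c = v := by
  have e : frameCoords a b c v =
    (doubleArea a v c / doubleArea a b c, doubleArea a b v / doubleArea a b c) := rfl
  rw [e]
  ext i
  fin_cases i
  · simp only [PiLp.add_apply, PiLp.smul_apply, smul_eq_mul, Fin.zero_eta, Fin.isValue]
    field_simp
    simp only [doubleArea]
    ring
  · simp only [PiLp.add_apply, PiLp.smul_apply, smul_eq_mul, Fin.mk_one, Fin.isValue]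
    field_simp
    simp only [doubleArea]
    ring

theorem frameCell_subset_interior {a b c : Plane} (h : doubleArea a b c ≠ 0) {K : Set Plane}
    (hK : Convex ℝ K) (ha : a ∈ K) (hb : b ∈ K) (hc : c ∈ K) :
    frameCell a b c ⊆ interior K := by
  refine interior_maximal (fun v hv => ?_) (isOpen_frameCell a b c)
  obtain ⟨⟨h1, h2⟩, h3, h4⟩ := hv
  rw [← eq_frame_combination h v]
  set s := (frameCoords a b c v).1
  set t := (frameCoords a b c v).2
  have := hK.sum_mem (t := Finset.univ) (w := ![1 - s - t, s, t]) (z := ![a, b, c])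
    (by
      intro i _
      fin_cases i
      · simp; linarith
      · simp; linarith
      · simp; linarith)
    (by simp [Fin.sum_univ_three]; ring)
    (by
      intro i _
      fin_cases i <;> simpa)
  simpa [Fin.sum_univ_three] using this

theorem volume_frameCell {a b c : Plane} (h : doubleArea a b c ≠ 0) :
    4 * volume (frameCell a b c) = ENNReal.ofReal |doubleArea a b c| := by
  have h1 := Measure.map_apply (μ := (volume : Measure Plane))
    (continuous_frameCoords a b c).measurable
    (measurableSet_Ioo.prod measurableSet_Ioo :
      MeasurableSet ((Set.Ioo 0 (1 / 2) : Set ℝ) ×ˢ (Set.Ioo 0 (1 / 2) : Set ℝ)))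
  rw [map_frameCoords_volume h, Measure.smul_apply, Measure.volume_eq_prod, Measure.prod_prod,
    Real.volume_Ioo, smul_eq_mul, ← ENNReal.ofReal_mul (by norm_num),
    ← ENNReal.ofReal_mul (abs_nonneg _)] at h1
  rw [frameCell, ← h1, show (4 : ENNReal) = ENNReal.ofReal 4 by simp,
    ← ENNReal.ofReal_mul (by norm_num)]
  congr 1
  ring

section Region

variable {R : Set Plane}

theorem cond_frameCell (hconv : Convex ℝ R) (hint : (interior R).Nonempty) {a b c : Plane}
    (h : doubleArea a b c ≠ 0) (ha : a ∈ closure R) (hb : b ∈ closure R) (hc : c ∈ closure R) :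
    4 * ProbabilityTheory.cond (volume : Measure Plane) R (frameCell a b c) =
      (volume R)⁻¹ * ENNReal.ofReal |doubleArea a b c| := by
  have hsub : frameCell a b c ⊆ R := by
    have := frameCell_subset_interior h hconv.closure ha hb hc
    rw [hconv.interior_closure_eq_interior_of_nonempty_interior hint] at this
    exact this.trans interior_subset
  rw [cond_apply_of_subset (isOpen_frameCell a b c).measurableSet hsub, mul_left_comm,
    volume_frameCell h]

theorem pi_cond_chains_le (hconv : Convex ℝ R) (hbdd : Bornology.IsBounded R)
    (hint : (interior R).Nonempty) {a b c : Plane}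
    (h : doubleArea a b c ≠ 0) (ha : a ∈ closure R) (hb : b ∈ closure R) (hc : c ∈ closure R)
    (m : ℕ) :
    (m.factorial : ENNReal) ^ 2 *
      Measure.pi (fun _ : Fin m => ProbabilityTheory.cond (volume : Measure Plane) R)
        {y | (fun l => frameCoords a b c (y l)) ∈ squareChains m} ≤
      2 * (16 * ProbabilityTheory.cond (volume : Measure Plane) R (frameCell a b c)) ^ m := by
  have := isProbabilityMeasure_cond hbdd hint
  set μ := ProbabilityTheory.cond (volume : Measure Plane) R with hμ
  have hmeas := (continuous_frameCoords a b c).measurable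
  -- The cell has a quarter of the area `|doubleArea a b c|`, so `κ` is exactly the density bound of
  -- the sample law in frame coordinates.
  set κ := 4 * μ (frameCell a b c) with hκ
  have hκt : κ ≠ ⊤ := ENNReal.mul_ne_top (by simp) (measure_ne_top _ _)
  have hle : μ.map (frameCoords a b c) ≤ κ • volume := by
    calc μ.map (frameCoords a b c) ≤ ((volume R)⁻¹ • volume).map (frameCoords a b c) :=
          Measure.map_mono cond_le_smul_volume hmeas
      _ = κ • volume := by
          rw [Measure.map_smul, map_frameCoords_volume h, smul_smul, hκ,
            cond_frameCell hconv hint h ha hb hc]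
  have : IsProbabilityMeasure (μ.map (frameCoords a b c)) :=
    Measure.isProbabilityMeasure_map hmeas.aemeasurable
  have key := pi_squareChains_le (μ.map (frameCoords a b c)) κ hκt hle m
  rw [← Measure.pi_map_pi (fun _ => hmeas.aemeasurable),
    Measure.map_apply (by fun_prop) (measurableSet_squareChains m)] at key
  refine key.trans (le_of_eq ?_)
  rw [hκ, ← mul_assoc]
  norm_num

end Region

/-- Combine `(r x)^m ≤ m! exp (r x)` with `(1 - x)^r ≤ exp (-r x)`. A large cell is hard to avoid
and a small one makes the chain unlikely, so the bound is uniform in `x`. -/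
theorem pow_mul_one_sub_pow_le {x : ℝ} (h0 : 0 ≤ x) (h1 : x ≤ 1) (m : ℕ) {r : ℕ} (hr : 0 < r) :
    x ^ m * (1 - x) ^ r ≤ m.factorial / (r : ℝ) ^ m := by
  have hr' : (0 : ℝ) < r := by exact_mod_cast hr
  have e1 : (1 - x) ^ r ≤ Real.exp (-(r * x)) := by
    calc (1 - x) ^ r ≤ (Real.exp (-x)) ^ r := by
          gcongr
          linarith [Real.add_one_le_exp (-x)]
      _ = Real.exp (-(r * x)) := by rw [← Real.exp_nat_mul]; ring_nf
  have e2 := Real.pow_div_factorial_le_exp (r * x) (by positivity) m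
  rw [div_le_iff₀ (by positivity), mul_pow] at e2
  rw [le_div_iff₀ (by positivity)]
  calc x ^ m * (1 - x) ^ r * (r : ℝ) ^ m
      = ((r : ℝ) ^ m * x ^ m) * (1 - x) ^ r := by ring
    _ ≤ (Real.exp (r * x) * m.factorial) * Real.exp (-(r * x)) := by
        gcongr
    _ = m.factorial := by
        rw [mul_right_comm, ← Real.exp_add]; simp

/-- The numerical bound for a chain of `m` points together with an empty cell of
probability `x`. -/
theorem chain_mul_empty_le {A x : ENNReal} {m r : ℕ} (hr : 0 < r) (hx : x ≤ 1)
    (hA : (m.factorial : ENNReal) ^ 2 * A ≤ 2 * (16 * x) ^ m) :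
    A * (1 - x) ^ r ≤ ENNReal.ofReal (2 * 16 ^ m / (m.factorial * (r : ℝ) ^ m)) := by
  have hxt : x ≠ ⊤ := (hx.trans_lt ENNReal.one_lt_top).ne
  obtain ⟨y, hy0, rfl⟩ : ∃ y : ℝ, 0 ≤ y ∧ x = ENNReal.ofReal y :=
    ⟨x.toReal, ENNReal.toReal_nonneg, (ENNReal.ofReal_toReal hxt).symm⟩
  have hy1 : y ≤ 1 := by simpa using hx
  have hr' : (0 : ℝ) < r := by exact_mod_cast hr
  have hm : (0 : ℝ) < m.factorial := by exact_mod_cast m.factorial_pos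
  have hA' : A ≤ ENNReal.ofReal (2 * (16 * y) ^ m / (m.factorial : ℝ) ^ 2) := by
    rw [ENNReal.ofReal_div_of_pos (by positivity), ENNReal.le_div_iff_mul_le
      (Or.inl (by simp [m.factorial_ne_zero])) (Or.inl (by simp)), mul_comm]
    convert hA using 1
    · rw [ENNReal.ofReal_pow hm.le, ENNReal.ofReal_natCast]
    · rw [ENNReal.ofReal_mul (by norm_num), ENNReal.ofReal_pow (by positivity),
        ENNReal.ofReal_mul (by norm_num)]
      simp
  have h1 : (1 - ENNReal.ofReal y) ^ r = ENNReal.ofReal ((1 - y) ^ r) := by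
    rw [ENNReal.ofReal_pow (by linarith), ENNReal.ofReal_sub _ hy0, ENNReal.ofReal_one]
  rw [h1]
  refine (mul_le_mul_left hA' _).trans ?_
  rw [← ENNReal.ofReal_mul (by positivity)]
  refine ENNReal.ofReal_le_ofReal ?_
  have key := pow_mul_one_sub_pow_le hy0 hy1 m hr
  calc 2 * (16 * y) ^ m / (m.factorial : ℝ) ^ 2 * (1 - y) ^ r
      = 2 * 16 ^ m / (m.factorial : ℝ) ^ 2 * (y ^ m * (1 - y) ^ r) := by
        rw [mul_pow]; ring
    _ ≤ 2 * 16 ^ m / (m.factorial : ℝ) ^ 2 * (m.factorial / (r : ℝ) ^ m) := by gcongr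
    _ = _ := by field_simp

/-! ### Chains near an empty cell -/

/-- Three points with index in `Fin 3` span a frame, those with index in `Fin m` form a monotone
chain in the square of that frame, and the others avoid the cell of the frame. -/
def emptyFrameChains (m : ℕ) (ρ : Type*) : Set (Fin 3 ⊕ (Fin m ⊕ ρ) → Plane) :=
  {x | doubleArea (x (.inl 0)) (x (.inl 1)) (x (.inl 2)) ≠ 0 ∧
    (fun l => frameCoords (x (.inl 0)) (x (.inl 1)) (x (.inl 2)) (x (.inr (.inl l)))) ∈
      squareChains m ∧
    ∀ i, x (.inr (.inr i)) ∉ frameCell (x (.inl 0)) (x (.inl 1)) (x (.inl 2))}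

theorem measurableSet_emptyFrameChains (m : ℕ) (ρ : Type*) [Countable ρ] :
    MeasurableSet (emptyFrameChains m ρ) := by
  have hf (j : Fin 3 ⊕ (Fin m ⊕ ρ)) : Measurable fun x : Fin 3 ⊕ (Fin m ⊕ ρ) → Plane =>
      frameCoords (x (.inl 0)) (x (.inl 1)) (x (.inl 2)) (x j) :=
    measurable_frameCoords.comp
      (f := fun x : Fin 3 ⊕ (Fin m ⊕ ρ) → Plane =>
        ((x (.inl 0), x (.inl 1), x (.inl 2)), x j))
      (((measurable_pi_apply (.inl 0)).prodMk
        ((measurable_pi_apply (.inl 1)).prodMk (measurable_pi_apply (.inl 2)))).prodMk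
        (measurable_pi_apply j))
  have h1 : MeasurableSet {x : Fin 3 ⊕ (Fin m ⊕ ρ) → Plane |
      doubleArea (x (.inl 0)) (x (.inl 1)) (x (.inl 2)) = 0} := by
    refine measurableSet_eq_fun ?_ measurable_const
    unfold doubleArea
    fun_prop
  refine h1.compl.inter (MeasurableSet.inter ?_ ?_)
  · exact (measurableSet_squareChains m).preimage (measurable_pi_lambda _ fun l => hf _)
  · have : {x : Fin 3 ⊕ (Fin m ⊕ ρ) → Plane |
        ∀ i, x (.inr (.inr i)) ∉ frameCell (x (.inl 0)) (x (.inl 1)) (x (.inl 2))} =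
        ⋂ i : ρ, {x | frameCoords (x (.inl 0)) (x (.inl 1)) (x (.inl 2)) (x (.inr (.inr i))) ∈
          (Set.Ioo 0 (1 / 2) : Set ℝ) ×ˢ (Set.Ioo 0 (1 / 2) : Set ℝ)}ᶜ := by
      ext x
      rw [Set.mem_iInter]
      rfl
    change MeasurableSet {x : Fin 3 ⊕ (Fin m ⊕ ρ) → Plane |
        ∀ i, x (.inr (.inr i)) ∉ frameCell (x (.inl 0)) (x (.inl 1)) (x (.inl 2))}
    rw [this]
    exact MeasurableSet.iInter fun i =>
      ((measurableSet_Ioo.prod measurableSet_Ioo).preimage (hf _)).compl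

theorem pi_emptyFrameChains_le {R : Set Plane} (hconv : Convex ℝ R) (hbdd : Bornology.IsBounded R)
    (hint : (interior R).Nonempty) (m : ℕ) {ρ : Type*} [Fintype ρ] [Nonempty ρ] :
    Measure.pi (fun _ => ProbabilityTheory.cond (volume : Measure Plane) R)
      (emptyFrameChains m ρ) ≤
      ENNReal.ofReal (2 * 16 ^ m / (m.factorial * (Fintype.card ρ : ℝ) ^ m)) := by
  have := isProbabilityMeasure_cond hbdd hint
  set μ := ProbabilityTheory.cond (volume : Measure Plane) R with hμ
  have hE := measurableSet_emptyFrameChains m ρ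
  have mp1 := (measurePreserving_sumPiEquivProdPi (X := fun _ : Fin 3 ⊕ (Fin m ⊕ ρ) => Plane)
    fun _ => μ)
  have mp2 := (measurePreserving_sumPiEquivProdPi (X := fun _ : Fin m ⊕ ρ => Plane) fun _ => μ)
  rw [← mp1.symm.measure_preimage hE.nullMeasurableSet,
    Measure.prod_apply ((MeasurableEquiv.measurable _) hE)]
  have hae : ∀ᵐ z ∂Measure.pi (fun _ : Fin 3 => μ), ∀ i, z i ∈ closure R := by
    rw [ae_all_iff]
    intro i
    exact (Measure.quasiMeasurePreserving_eval (fun _ : Fin 3 => μ) i).ae ae_cond_mem_closure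
  -- Condition on the frame `z`. The chain and the avoidance of the cell then concern disjoint
  -- groups of independent points, and the bound obtained does not depend on `z`.
  refine (lintegral_mono_ae (g := fun _ => _) (hae.mono fun z hz => ?_)).trans
    (le_of_eq (by rw [lintegral_const, measure_univ, mul_one]))
  set S := Prod.mk z ⁻¹' ((MeasurableEquiv.sumPiEquivProdPi
    (fun _ : Fin 3 ⊕ (Fin m ⊕ ρ) => Plane)).symm ⁻¹' emptyFrameChains m ρ) with hS
  have hSm : MeasurableSet S := measurable_prodMk_left ((MeasurableEquiv.measurable _) hE)
  change Measure.pi (fun _ : Fin m ⊕ ρ => μ) S ≤ _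
  rw [← mp2.symm.measure_preimage hSm.nullMeasurableSet]
  by_cases hD : doubleArea (z 0) (z 1) (z 2) = 0
  · have h0 : S = ∅ := Set.eq_empty_of_forall_notMem fun y hy => hy.1 hD
    simp [h0]
  · have hsub : (MeasurableEquiv.sumPiEquivProdPi (fun _ : Fin m ⊕ ρ => Plane)).symm ⁻¹' S ⊆
        {y | (fun l => frameCoords (z 0) (z 1) (z 2) (y l)) ∈ squareChains m} ×ˢ
          (Set.univ.pi fun _ : ρ => (frameCell (z 0) (z 1) (z 2))ᶜ) := by
      rintro ⟨y, w⟩ ⟨-, h2, h3⟩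
      exact ⟨h2, fun i _ => h3 i⟩
    refine (measure_mono hsub).trans ?_
    rw [Measure.prod_prod, Measure.pi_pi, Finset.prod_const, Finset.card_univ,
      prob_compl_eq_one_sub (isOpen_frameCell _ _ _).measurableSet]
    exact chain_mul_empty_le Fintype.card_pos prob_le_one
      (pi_cond_chains_le hconv hbdd hint hD (hz 0) (hz 1) (hz 2) m)

/-- The event that the points with indices given by `g` are a frame and a chain whose cell is
avoided by all other points. -/
def frameChainEvent {n m : ℕ} (g : Fin 3 ⊕ Fin m ↪ Fin n) : Set (Fin n → Plane) :=
  {x | doubleArea (x (g (.inl 0))) (x (g (.inl 1))) (x (g (.inl 2))) ≠ 0 ∧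
    (fun l => frameCoords (x (g (.inl 0))) (x (g (.inl 1))) (x (g (.inl 2))) (x (g (.inr l)))) ∈
      squareChains m ∧
    ∀ i ∉ Set.range g, x i ∉ frameCell (x (g (.inl 0))) (x (g (.inl 1))) (x (g (.inl 2)))}

theorem uniformPoints_frameChainEvent_le {R : Set Plane} (hconv : Convex ℝ R)
    (hbdd : Bornology.IsBounded R) (hint : (interior R).Nonempty) {m n r : ℕ} (hr : 0 < r)
    (hn : n = 3 + m + r) (g : Fin 3 ⊕ Fin m ↪ Fin n) :
    uniformPoints R n (frameChainEvent g) ≤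
      ENNReal.ofReal (2 * 16 ^ m / (m.factorial * (r : ℝ) ^ m)) := by
  classical
  have := isProbabilityMeasure_cond hbdd hint
  let ρ : Type := ↥(Set.range g)ᶜ
  let e : Fin 3 ⊕ (Fin m ⊕ ρ) ≃ Fin n :=
    (Equiv.sumAssoc _ _ _).symm.trans
      ((Equiv.sumCongr (Equiv.ofInjective g g.injective) (Equiv.refl ρ)).trans
        (Equiv.Set.sumCompl (Set.range g)))
  have hcard : Fintype.card ρ = r := by
    have := Fintype.card_congr e
    simp only [Fintype.card_sum, Fintype.card_fin] at this
    omega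
  have : Nonempty ρ := Fintype.card_pos_iff.1 (by omega)
  have h := pi_emptyFrameChains_le hconv hbdd hint m (ρ := ρ)
  rw [hcard, ← pi_preimage_comp_equiv _ e (measurableSet_emptyFrameChains m ρ)] at h
  refine (measure_mono ?_).trans h
  rintro x ⟨h1, h2, h3⟩
  exact ⟨h1, h2, fun i => h3 _ i.2⟩

/-! ### Large holes contain long monotone chains -/

theorem exists_convex_combination_eq {x y p : ℝ} (h1 : x ≤ p) (h2 : p ≤ y) :
    ∃ α β : ℝ, 0 ≤ α ∧ 0 ≤ β ∧ α + β = 1 ∧ α * x + β * y = p := by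
  have : p ∈ segment ℝ x y := by
    rw [segment_eq_Icc (h1.trans h2)]; exact ⟨h1, h2⟩
  obtain ⟨α, β, h⟩ := this
  exact ⟨α, β, by simpa using h⟩

/-- A convex set that meets all four closed quadrants at `p` contains `p`. -/
theorem Convex.mem_of_quadrants {K : Set (ℝ × ℝ)} (hK : Convex ℝ K) {p q₁ q₂ q₃ q₄ : ℝ × ℝ}
    (h₁ : q₁ ∈ K) (h₂ : q₂ ∈ K) (h₃ : q₃ ∈ K) (h₄ : q₄ ∈ K)
    (a₁ : p.1 ≤ q₁.1) (b₁ : p.2 ≤ q₁.2) (a₂ : q₂.1 ≤ p.1) (b₂ : p.2 ≤ q₂.2)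
    (a₃ : q₃.1 ≤ p.1) (b₃ : q₃.2 ≤ p.2) (a₄ : p.1 ≤ q₄.1) (b₄ : q₄.2 ≤ p.2) : p ∈ K := by
  -- The segments `q₂ q₁` and `q₃ q₄` meet the vertical line through `p` above and below `p`; `p`
  -- lies between these two points.
  obtain ⟨α, β, hα, hβ, hs, he⟩ := exists_convex_combination_eq a₂ a₁
  obtain ⟨γ, δ, hγ, hδ, hs', he'⟩ := exists_convex_combination_eq a₃ a₄
  have hu := hK h₂ h₁ hα hβ hs
  have hw := hK h₃ h₄ hγ hδ hs'
  have hu2 : p.2 ≤ (α • q₂ + β • q₁).2 := by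
    simp only [Prod.snd_add, Prod.smul_snd, smul_eq_mul]
    have e : α * p.2 + β * p.2 = p.2 := by rw [← add_mul, hs, one_mul]
    linarith [mul_le_mul_of_nonneg_left b₂ hα, mul_le_mul_of_nonneg_left b₁ hβ]
  have hw2 : (γ • q₃ + δ • q₄).2 ≤ p.2 := by
    simp only [Prod.snd_add, Prod.smul_snd, smul_eq_mul]
    have e : γ * p.2 + δ * p.2 = p.2 := by rw [← add_mul, hs', one_mul]
    linarith [mul_le_mul_of_nonneg_left b₃ hγ, mul_le_mul_of_nonneg_left b₄ hδ]
  have hu1 : (α • q₂ + β • q₁).1 = p.1 := by simpa using he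
  have hw1 : (γ • q₃ + δ • q₄).1 = p.1 := by simpa using he'
  obtain ⟨ε, ζ, hε, hζ, hs'', he''⟩ := exists_convex_combination_eq hw2 hu2
  convert hK hw hu hε hζ hs'' using 1
  refine Prod.ext ?_ ?_
  · rw [Prod.fst_add, Prod.smul_fst, Prod.smul_fst, hu1, hw1, smul_eq_mul, smul_eq_mul,
      ← add_mul, hs'', one_mul]
  · rw [Prod.snd_add, Prod.smul_snd, Prod.smul_snd, smul_eq_mul, smul_eq_mul, he'']

theorem Convex.mem_of_frame_quadrants {K : Set Plane} (hK : Convex ℝ K) {a b c : Plane}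
    (h : doubleArea a b c ≠ 0) {p q₁ q₂ q₃ q₄ : Plane}
    (h₁ : q₁ ∈ K) (h₂ : q₂ ∈ K) (h₃ : q₃ ∈ K) (h₄ : q₄ ∈ K)
    (a₁ : (frameCoords a b c p).1 ≤ (frameCoords a b c q₁).1)
    (b₁ : (frameCoords a b c p).2 ≤ (frameCoords a b c q₁).2)
    (a₂ : (frameCoords a b c q₂).1 ≤ (frameCoords a b c p).1)
    (b₂ : (frameCoords a b c p).2 ≤ (frameCoords a b c q₂).2)
    (a₃ : (frameCoords a b c q₃).1 ≤ (frameCoords a b c p).1)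
    (b₃ : (frameCoords a b c q₃).2 ≤ (frameCoords a b c p).2)
    (a₄ : (frameCoords a b c p).1 ≤ (frameCoords a b c q₄).1)
    (b₄ : (frameCoords a b c q₄).2 ≤ (frameCoords a b c p).2) : p ∈ K := by
  let L : ℝ × ℝ →ₗ[ℝ] Plane :=
    (LinearMap.fst ℝ ℝ ℝ).smulRight (b - a) + (LinearMap.snd ℝ ℝ ℝ).smulRight (c - a)
  have hL (v : Plane) : a + L (frameCoords a b c v) = v := by
    conv_rhs => rw [← eq_frame_combination h v]
    simp only [L, LinearMap.add_apply, LinearMap.smulRight_apply, LinearMap.fst_apply,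
      LinearMap.snd_apply]
    module
  have hc : Convex ℝ (L ⁻¹' ((fun z => a + z) ⁻¹' K)) :=
    (hK.translate_preimage_right a).linear_preimage L
  have hmem {v : Plane} : frameCoords a b c v ∈ L ⁻¹' ((fun z => a + z) ⁻¹' K) ↔ v ∈ K := by
    rw [Set.mem_preimage, Set.mem_preimage, hL]
  exact hmem.1 (hc.mem_of_quadrants (hmem.2 h₁) (hmem.2 h₂) (hmem.2 h₃) (hmem.2 h₄)
    a₁ b₁ a₂ b₂ a₃ b₃ a₄ b₄)

/-- The sign `1` or `-1` that belongs to a Boolean. -/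
def boolSign (s : Bool) : ℝ := if s then 1 else -1

theorem exists_free_quadrant {V : Finset Plane}
    (hV : ∀ v ∈ V, v ∉ convexHull ℝ ((V : Set Plane) \ {v})) {a b c : Plane}
    (h : doubleArea a b c ≠ 0) {p : Plane} (hp : p ∈ V) :
    ∃ σ : Bool × Bool, ∀ q ∈ V, q ≠ p →
      ¬(boolSign σ.1 * (frameCoords a b c p).1 ≤ boolSign σ.1 * (frameCoords a b c q).1 ∧
        boolSign σ.2 * (frameCoords a b c p).2 ≤ boolSign σ.2 * (frameCoords a b c q).2) := by
  by_contra! hcon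
  obtain ⟨q₁, m₁, n₁, a₁, b₁⟩ := hcon (true, true)
  obtain ⟨q₂, m₂, n₂, a₂, b₂⟩ := hcon (false, true)
  obtain ⟨q₃, m₃, n₃, a₃, b₃⟩ := hcon (false, false)
  obtain ⟨q₄, m₄, n₄, a₄, b₄⟩ := hcon (true, false)
  simp only [boolSign, if_true, Bool.false_eq_true, if_false, one_mul, neg_one_mul,
    neg_le_neg_iff] at a₁ b₁ a₂ b₂ a₃ b₃ a₄ b₄
  have hs {q : Plane} (hq : q ∈ V) (hne : q ≠ p) :
      q ∈ convexHull ℝ ((V : Set Plane) \ {p}) := subset_convexHull _ _ ⟨hq, hne⟩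
  exact hV p hp ((convex_convexHull ℝ _).mem_of_frame_quadrants h (hs m₁ n₁) (hs m₂ n₂)
    (hs m₃ n₃) (hs m₄ n₄) a₁ b₁ a₂ b₂ a₃ b₃ a₄ b₄)

theorem collinear_of_doubleArea_eq_zero {a b c : Plane} (h : doubleArea a b c = 0) :
    Collinear ℝ {a, b, c} := by
  by_cases hab : a = b
  · subst hab
    simpa using collinear_pair ℝ a c
  · refine (collinear_iff_of_mem (p₀ := a) (by simp)).2 ⟨b - a, ?_⟩
    unfold doubleArea at h
    have key : ∃ r : ℝ, c = r • (b - a) +ᵥ a := by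
      by_cases h0 : b 0 - a 0 = 0
      · have h1 : b 1 - a 1 ≠ 0 := by
          intro h1
          apply hab
          ext i
          fin_cases i
          · simp; linarith
          · simp; linarith
        refine ⟨(c 1 - a 1) / (b 1 - a 1), ?_⟩
        rw [h0, zero_mul, zero_sub, neg_eq_zero, mul_eq_zero] at h
        have h2 := h.resolve_left h1
        ext i
        fin_cases i
        · simp [h0]; linarith
        · simp; field_simp; ring
      · refine ⟨(c 0 - a 0) / (b 0 - a 0), ?_⟩
        ext i
        fin_cases i
        · simp; field_simp; ring
        · simp; field_simp; linarith
    obtain ⟨r, hr⟩ := key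
    intro p hp
    simp only [Set.mem_insert_iff, Set.mem_singleton_iff] at hp
    rcases hp with rfl | rfl | rfl
    · exact ⟨0, by simp⟩
    · exact ⟨1, by simp⟩
    · exact ⟨r, hr⟩

theorem doubleArea_ne_zero_of_convexPosition {V : Finset Plane}
    (hV : ∀ v ∈ V, v ∉ convexHull ℝ ((V : Set Plane) \ {v})) {a b c : Plane}
    (ha : a ∈ V) (hb : b ∈ V) (hc : c ∈ V) (hab : a ≠ b) (hac : a ≠ c) (hbc : b ≠ c) :
    doubleArea a b c ≠ 0 := by
  intro h
  have key {u v w : Plane} (hu : u ∈ V) (hv : v ∈ V) (hw : w ∈ V) (huv : u ≠ v) (hwv : w ≠ v)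
      (hb : Wbtw ℝ u v w) : False := by
    refine hV v hv ?_
    have h1 := hb.mem_segment
    exact (convex_convexHull ℝ ((V : Set Plane) \ {v})).segment_subset
      (subset_convexHull _ _ ⟨hu, huv⟩) (subset_convexHull _ _ ⟨hw, hwv⟩) h1
  rcases (collinear_of_doubleArea_eq_zero h).wbtw_or_wbtw_or_wbtw with hw | hw | hw
  · exact key ha hb hc hab hbc.symm hw
  · exact key hb hc ha hbc hac hw
  · exact key hc ha hb hac.symm hab.symm hw

/-- Take the triangle of maximal area: a frame coordinate is the ratio of the signed areas of the
triangle with one vertex replaced and the triangle itself. -/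
theorem exists_max_frame {V : Finset Plane} (h3 : 3 ≤ V.card)
    (hV : ∀ v ∈ V, v ∉ convexHull ℝ ((V : Set Plane) \ {v})) :
    ∃ a ∈ V, ∃ b ∈ V, ∃ c ∈ V, doubleArea a b c ≠ 0 ∧
      ∀ v ∈ V, frameCoords a b c v ∈ Set.Icc (-1 : ℝ) 1 ×ˢ Set.Icc (-1 : ℝ) 1 := by
  obtain ⟨u, hu, v, hv, w, hw, huv, huw, hvw⟩ := Finset.two_lt_card.1 h3
  obtain ⟨⟨a, b, c⟩, hmem, hmax⟩ := Finset.exists_max_image (V ×ˢ V ×ˢ V)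
    (fun p => |doubleArea p.1 p.2.1 p.2.2|) ⟨(u, v, w), by simp [hu, hv, hw]⟩
  simp only [Finset.mem_product] at hmem
  obtain ⟨ha, hb, hc⟩ := hmem
  have hD : 0 < |doubleArea a b c| :=
    (abs_pos.2 (doubleArea_ne_zero_of_convexPosition hV hu hv hw huv huw hvw)).trans_le
      (hmax (u, v, w) (by simp [hu, hv, hw]))
  refine ⟨a, ha, b, hb, c, hc, abs_pos.1 hD, fun p hp => ?_⟩
  have h1 := hmax (a, p, c) (by simp [ha, hp, hc])
  have h2 := hmax (a, b, p) (by simp [ha, hp, hb])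
  refine ⟨abs_le.1 ?_, abs_le.1 ?_⟩
  · simp only [frameCoords, abs_div]
    exact (div_le_one hD).2 h1
  · simp only [frameCoords, abs_div]
    exact (div_le_one hD).2 h2

theorem exists_strictMono_enumeration {α : Type*} (S : Finset α) (f : α → ℝ)
    (hf : Set.InjOn f S) :
    ∃ p : Fin S.card → α, (∀ l, p l ∈ S) ∧ StrictMono (f ∘ p) := by
  classical
  have hcard : (S.image f).card = S.card := Finset.card_image_of_injOn hf
  have hex (l : Fin S.card) : ∃ v ∈ S, f v = (S.image f).orderEmbOfFin hcard l :=
    Finset.mem_image.1 (Finset.orderEmbOfFin_mem _ hcard l)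
  choose p hp hpe using hex
  refine ⟨p, hp, fun i j hij => ?_⟩
  simp only [Function.comp_apply, hpe]
  exact ((S.image f).orderEmbOfFin hcard).strictMono hij

/-- Points sharing a free quadrant form an antichain for the matching coordinate order. Sorted by
the first coordinate, the second decreases if the two signs of `σ` agree and increases otherwise. -/
theorem exists_chain_of_free_quadrant {a b c : Plane} {σ : Bool × Bool} {S : Finset Plane}
    (hS : ∀ p ∈ S, ∀ q ∈ S, q ≠ p →
      ¬(boolSign σ.1 * (frameCoords a b c p).1 ≤ boolSign σ.1 * (frameCoords a b c q).1 ∧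
        boolSign σ.2 * (frameCoords a b c p).2 ≤ boolSign σ.2 * (frameCoords a b c q).2)) :
    ∃ p : Fin S.card → Plane, (∀ l, p l ∈ S) ∧ Function.Injective p ∧
      StrictMono (fun l => (frameCoords a b c (p l)).1) ∧
      (StrictMono (fun l => (frameCoords a b c (p l)).2) ∨
        StrictAnti fun l => (frameCoords a b c (p l)).2) := by
  have hinj : Set.InjOn (fun v => (frameCoords a b c v).1) S := by
    intro p hp q hq e
    by_contra hne
    have e' : (frameCoords a b c p).1 = (frameCoords a b c q).1 := e
    have h1 := hS p hp q hq (Ne.symm hne)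
    have h2 := hS q hq p hp hne
    rw [e'] at h1 h2
    simp only [le_refl, true_and, not_le] at h1 h2
    exact lt_asymm h1 h2
  obtain ⟨p, hp, hmono⟩ := exists_strictMono_enumeration S _ hinj
  have hpinj : Function.Injective p := fun i j e => hmono.injective (by simp [e])
  refine ⟨p, hp, hpinj, hmono, ?_⟩
  have key {i j : Fin S.card} (hij : i < j) := hS _ (hp i) _ (hp j) (hpinj.ne hij.ne')
  have key' {i j : Fin S.card} (hij : i < j) := hS _ (hp j) _ (hp i) (hpinj.ne hij.ne)
  have hlt {i j : Fin S.card} (hij : i < j) :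
      (frameCoords a b c (p i)).1 < (frameCoords a b c (p j)).1 := hmono hij
  obtain ⟨s, t⟩ := σ
  cases s <;> cases t
  · right; intro i j hij
    have := key' hij
    simp [boolSign, (hlt hij).le] at this
    exact this
  · left; intro i j hij
    have := key' hij
    simp [boolSign, (hlt hij).le] at this
    exact this
  · left; intro i j hij
    have := key hij
    simp [boolSign, (hlt hij).le] at this
    exact this
  · right; intro i j hij
    have := key hij
    simp [boolSign, (hlt hij).le] at this
    exact this

theorem exists_frameChainEvent {n m : ℕ} {x : Fin n → Plane} (h : 4 * m + 3 ≤ hol (pointSet x)) :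
    ∃ g : Fin 3 ⊕ Fin m ↪ Fin n, x ∈ frameChainEvent g := by
  classical
  obtain ⟨V, ⟨hVP, h3, hci, hint⟩, hcard⟩ := (le_hol_iff (by omega)).1 h
  have hV := (convexIndependent_set_iff_notMem_convexHull_sdiff (s := (V : Set Plane))).1 hci
  obtain ⟨a, ha, b, hb, c, hc, hD, hbox⟩ := exists_max_frame h3 hV
  have hab : a ≠ b := by rintro rfl; exact hD (by simp [doubleArea])
  have hac : a ≠ c := by rintro rfl; exact hD (by simp [doubleArea])
  have hbc : b ≠ c := by rintro rfl; exact hD (by simp [doubleArea]; ring)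
  choose! col hcol using fun p hp => exists_free_quadrant hV hD (p := p) hp
  -- Dropping the frame costs three vertices and the pigeonhole over four quadrants a factor 4,
  -- whence `4 * m + 3`.
  have hV' : 4 * m ≤ (V \ {a, b, c}).card := by
    have := Finset.le_card_sdiff {a, b, c} V
    have h4 : ({a, b, c} : Finset Plane).card ≤ 3 := Finset.card_le_three
    omega
  obtain ⟨σ, -, hσ⟩ := Finset.exists_le_card_fiber_of_mul_le_card_of_maps_to
    (s := V \ {a, b, c}) (t := (Finset.univ : Finset (Bool × Bool))) (f := col) (n := m)
    (fun _ _ => Finset.mem_univ _) ⟨(true, true), Finset.mem_univ _⟩ (by simpa using hV')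
  obtain ⟨S, hSsub, rfl⟩ := Finset.exists_subset_card_eq hσ
  have hSV {v : Plane} (hv : v ∈ S) : v ∈ V ∧ v ∉ ({a, b, c} : Finset Plane) ∧ col v = σ := by
    have := Finset.mem_filter.1 (hSsub hv)
    exact ⟨(Finset.mem_sdiff.1 this.1).1, (Finset.mem_sdiff.1 this.1).2, this.2⟩
  obtain ⟨p, hp, hpinj, hp1, hp2⟩ := exists_chain_of_free_quadrant (a := a) (b := b) (c := c)
    (σ := σ) (S := S) (by
      intro p hp q hq hne
      have := hcol p (hSV hp).1 q (hSV hq).1 hne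
      rwa [(hSV hp).2.2] at this)
  have hidx : ∀ v ∈ V, ∃ i, x i = v := by
    intro v hv
    obtain ⟨i, -, hi⟩ := Finset.mem_image.1 (hVP hv)
    exact ⟨i, hi⟩
  let pt : Fin 3 ⊕ Fin S.card → Plane := Sum.elim ![a, b, c] p
  have hpt : ∀ j, pt j ∈ V := by
    rintro (j | j)
    · fin_cases j <;> simpa [pt]
    · exact (hSV (hp j)).1
  have hptinj : Function.Injective pt := by
    refine Function.Injective.sumElim ?_ hpinj ?_
    · intro i j
      fin_cases i <;> fin_cases j <;> simp [hab, hac, hbc, hab.symm, hac.symm, hbc.symm]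
    · intro i j e
      have := (hSV (hp j)).2.1
      rw [← e] at this
      fin_cases i <;> simp at this
  choose idx hxi using fun j => hidx (pt j) (hpt j)
  have e0 : x (idx (.inl 0)) = a := hxi _
  have e1 : x (idx (.inl 1)) = b := hxi _
  have e2 : x (idx (.inl 2)) = c := hxi _
  have e3 (l) : x (idx (.inr l)) = p l := hxi _
  refine ⟨⟨idx, fun i j e => hptinj (by rw [← hxi, ← hxi, e])⟩,
    show doubleArea (x (idx (.inl 0))) (x (idx (.inl 1))) (x (idx (.inl 2))) ≠ 0 ∧
      (fun l => frameCoords (x (idx (.inl 0))) (x (idx (.inl 1))) (x (idx (.inl 2)))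
        (x (idx (.inr l)))) ∈ squareChains S.card ∧
      ∀ i ∉ Set.range idx,
        x i ∉ frameCell (x (idx (.inl 0))) (x (idx (.inl 1))) (x (idx (.inl 2))) from ?_⟩
  simp only [e0, e1, e2, e3]
  refine ⟨hD, ⟨fun l => hbox _ (hSV (hp l)).1, hp1, hp2⟩, fun i _ hi => ?_⟩
  exact hint (x i) (by simp [pointSet]) (frameCell_subset_interior hD (convex_convexHull ℝ _)
    (subset_convexHull _ _ ha) (subset_convexHull _ _ hb) (subset_convexHull _ _ hc) hi)

theorem uniformPoints_hol_ge_le {R : Set Plane} (hconv : Convex ℝ R)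
    (hbdd : Bornology.IsBounded R) (hint : (interior R).Nonempty) {m n : ℕ}
    (hn : 2 * (m + 3) ≤ n) :
    uniformPoints R n {x | 4 * m + 3 ≤ hol (pointSet x)} ≤
      ENNReal.ofReal (2 * (n : ℝ) ^ 3 * (32 ^ m / m.factorial)) := by
  classical
  obtain ⟨r, rfl⟩ : ∃ r, n = 3 + m + r := ⟨n - (3 + m), by omega⟩
  have hr : 0 < r := by omega
  have hr' : (0 : ℝ) < r := by exact_mod_cast hr
  set n := 3 + m + r with hn'
  have hsub : {x : Fin n → Plane | 4 * m + 3 ≤ hol (pointSet x)} ⊆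
      ⋃ g : Fin 3 ⊕ Fin m ↪ Fin n, frameChainEvent g := fun x hx =>
    Set.mem_iUnion.2 (exists_frameChainEvent hx)
  refine (measure_mono hsub).trans ((measure_iUnion_fintype_le _ _).trans ?_)
  refine (Finset.sum_le_sum fun g _ =>
    uniformPoints_frameChainEvent_le hconv hbdd hint hr hn' g).trans ?_
  rw [Finset.sum_const, nsmul_eq_mul, Finset.card_univ, Fintype.card_embedding_eq,
    ← ENNReal.ofReal_natCast, ← ENNReal.ofReal_mul (by positivity)]
  refine ENNReal.ofReal_le_ofReal ?_
  simp only [Fintype.card_sum, Fintype.card_fin]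
  have h1 : ((n.descFactorial (3 + m) : ℕ) : ℝ) ≤ (n : ℝ) ^ 3 * (n : ℝ) ^ m := by
    rw [← pow_add]
    exact_mod_cast Nat.descFactorial_le_pow n (3 + m)
  -- The size condition on `n` gives `n ≤ 2 r`; this turns `16 ^ m` into `32 ^ m`.
  have h2 : (n : ℝ) ^ m ≤ 2 ^ m * (r : ℝ) ^ m := by
    rw [← mul_pow]
    have : n ≤ 2 * r := by omega
    gcongr
    exact_mod_cast this
  calc ((n.descFactorial (3 + m) : ℕ) : ℝ) * (2 * 16 ^ m / (m.factorial * (r : ℝ) ^ m))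
      ≤ ((n : ℝ) ^ 3 * (2 ^ m * (r : ℝ) ^ m)) * (2 * 16 ^ m / (m.factorial * (r : ℝ) ^ m)) := by
        gcongr
        exact h1.trans (by gcongr)
    _ = 2 * (n : ℝ) ^ 3 * ((2 * 16) ^ m / m.factorial) := by
        rw [mul_pow]
        field_simp
    _ = _ := by norm_num

/-! ### A second moment bound for occupied cells -/

/-- Chebyshev's inequality for the number `W` of events that occur: where none does, `(W - e)² =
e²`. -/
theorem measureReal_iInter_compl_le {Ω ι : Type*} [MeasurableSpace Ω] [Fintype ι]
    (P : Measure Ω) [IsProbabilityMeasure P] {A : ι → Set Ω} (hA : ∀ i, MeasurableSet (A i))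
    {e e₂ : ℝ} (he : ∑ i, P.real (A i) = e) (hpos : 0 < e)
    (he₂ : ∑ i, ∑ j, P.real (A i ∩ A j) ≤ e₂) :
    P.real (⋂ i, (A i)ᶜ) ≤ (e₂ - e ^ 2) / e ^ 2 := by
  classical
  let W : Ω → ℝ := fun ω => ∑ i, (A i).indicator 1 ω
  have hI (B : Set Ω) (hB : MeasurableSet B) : Integrable (B.indicator (1 : Ω → ℝ)) P :=
    (integrable_const (1 : ℝ)).indicator hB
  have hW : Integrable W P := integrable_finsetSum _ fun i _ => hI _ (hA i)
  have hWe : ∫ ω, W ω ∂P = e := by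
    rw [integral_finsetSum _ fun i _ => hI _ (hA i), ← he]
    exact Finset.sum_congr rfl fun i _ => integral_indicator_one (hA i)
  have hsq : (fun ω => W ω ^ 2) =
      fun ω => ∑ i, ∑ j, (A i ∩ A j).indicator (1 : Ω → ℝ) ω := by
    funext ω
    simp only [W, sq, Finset.sum_mul_sum, Set.inter_indicator_one, Pi.mul_apply]
  have hIij (i j : ι) := hI _ ((hA i).inter (hA j))
  have hW2 : Integrable (fun ω => W ω ^ 2) P := by
    rw [hsq]
    exact integrable_finsetSum _ fun i _ => integrable_finsetSum _ fun j _ => hIij i j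
  have hW2e : ∫ ω, W ω ^ 2 ∂P ≤ e₂ := by
    rw [hsq, integral_finsetSum _ fun i _ => integrable_finsetSum _ fun j _ => hIij i j]
    refine le_of_eq_of_le (Finset.sum_congr rfl fun i _ => ?_) he₂
    rw [integral_finsetSum _ fun j _ => hIij i j]
    exact Finset.sum_congr rfl fun j _ => integral_indicator_one ((hA i).inter (hA j))
  have hN : MeasurableSet (⋂ i, (A i)ᶜ) := MeasurableSet.iInter fun i => (hA i).compl
  have hle : ∫ ω, (⋂ i, (A i)ᶜ).indicator (1 : Ω → ℝ) ω * e ^ 2 ∂P ≤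
      ∫ ω, (W ω ^ 2 - 2 * e * W ω + e ^ 2) ∂P := by
    refine integral_mono ((hI _ hN).mul_const _)
      ((hW2.sub (hW.const_mul _)).add (integrable_const _)) fun ω => ?_
    by_cases hω : ω ∈ ⋂ i, (A i)ᶜ
    · have h0 : W ω = 0 := Finset.sum_eq_zero fun i _ =>
        Set.indicator_of_notMem (Set.mem_iInter.1 hω i) _
      simp [hω, h0]
    · simp only [Set.indicator_of_notMem hω, zero_mul]
      nlinarith [sq_nonneg (W ω - e)]
  have hWW : Integrable (fun ω => W ω ^ 2 - 2 * e * W ω) P := hW2.sub (hW.const_mul _)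
  rw [integral_mul_const, integral_indicator_one hN, integral_add hWW (integrable_const _),
    integral_sub hW2 (hW.const_mul _), integral_const_mul, hWe] at hle
  simp only [integral_const, probReal_univ, one_smul] at hle
  rw [le_div_iff₀ (by positivity)]
  nlinarith

theorem pi_embedding_eq {X κ : Type*} [MeasurableSpace X] [Fintype κ] {n : ℕ} (μ : Measure X)
    [IsProbabilityMeasure μ] (f : κ ↪ Fin n) {C : κ → Set X} (hC : ∀ l, MeasurableSet (C l))
    {D : Set X} (hD : MeasurableSet D) :
    (Measure.pi fun _ : Fin n => μ).real {x | (∀ l, x (f l) ∈ C l) ∧ ∀ i ∉ Set.range f, x i ∈ D} =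
      (∏ l, μ.real (C l)) * μ.real D ^ (n - Fintype.card κ) := by
  classical
  let ρ : Type := ↥(Set.range f)ᶜ
  let e : κ ⊕ ρ ≃ Fin n :=
    (Equiv.sumCongr (Equiv.ofInjective f f.injective) (Equiv.refl ρ)).trans
      (Equiv.Set.sumCompl (Set.range f))
  have hcard : Fintype.card ρ = n - Fintype.card κ := by
    have := Fintype.card_congr e
    simp only [Fintype.card_sum, Fintype.card_fin] at this
    omega
  let B : κ ⊕ ρ → Set X := Sum.elim C fun _ => D
  have hB : MeasurableSet (Set.univ.pi B) := by
    refine MeasurableSet.univ_pi ?_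
    rintro (l | i)
    · exact hC l
    · exact hD
  have h := pi_preimage_comp_equiv μ e hB
  rw [Measure.pi_pi, Fintype.prod_sum_type] at h
  have hset : {x : Fin n → X | (∀ l, x (f l) ∈ C l) ∧ ∀ i ∉ Set.range f, x i ∈ D} =
      {u | u ∘ e ∈ Set.univ.pi B} := by
    ext x
    constructor
    · rintro ⟨h1, h2⟩ (l | i) -
      · exact h1 l
      · exact h2 _ i.2
    · intro h
      exact ⟨fun l => h (.inl l) trivial, fun i hi => h (.inr ⟨i, hi⟩) trivial⟩
  rw [hset, Measure.real, h]
  simp only [B, Sum.elim_inl, Sum.elim_inr, Finset.prod_const, Finset.card_univ, hcard,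
    ENNReal.toReal_mul, ENNReal.toReal_prod, ENNReal.toReal_pow]
  rfl

/-- The event that the points with indices `f l` occupy the cells `C l` of the region `Q` and that
there are no other points in `Q`. -/
def occupied {X : Type*} {k n : ℕ} (Q : Set X) (C : Fin k → Set X) (f : Fin k ↪ Fin n) :
    Set (Fin n → X) :=
  {x | (∀ l, x (f l) ∈ C l) ∧ ∀ i ∉ Set.range f, x i ∈ Qᶜ}

theorem measurableSet_occupied {X : Type*} [MeasurableSpace X] {k n : ℕ} {Q : Set X}
    {C : Fin k → Set X} (hQ : MeasurableSet Q) (hC : ∀ l, MeasurableSet (C l))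
    (f : Fin k ↪ Fin n) : MeasurableSet (occupied Q C f) := by
  have : occupied Q C f = (⋂ l, (fun x : Fin n → X => x (f l)) ⁻¹' C l) ∩
      ⋂ i, ⋂ _ : i ∉ Set.range f, (fun x : Fin n → X => x i) ⁻¹' Qᶜ := by
    ext x
    simp [occupied]
  rw [this]
  exact (MeasurableSet.iInter fun l => (hC l).preimage (measurable_pi_apply _)).inter
    (MeasurableSet.iInter fun i => MeasurableSet.iInter fun _ =>
      hQ.compl.preimage (measurable_pi_apply i))

/-- The points in `Q` and the disjoint cells they occupy determine the labelling. -/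
theorem occupied_inter_eq_empty {X : Type*} {k n : ℕ} {Q : Set X} {C : Fin k → Set X}
    (hCQ : ∀ l, C l ⊆ Q) (hCd : Pairwise (Function.onFun Disjoint C)) {f g : Fin k ↪ Fin n}
    (hfg : f ≠ g) : occupied Q C f ∩ occupied Q C g = ∅ := by
  refine Set.eq_empty_of_forall_notMem fun x ⟨hf, hg⟩ => hfg ?_
  ext l
  have h1 : f l ∈ Set.range g := by
    by_contra h
    exact hg.2 _ h (hCQ l (hf.1 l))
  obtain ⟨l', hl'⟩ := h1
  have : l = l' := by
    by_contra hne
    exact Set.disjoint_left.1 (hCd hne) (hf.1 l) (hl' ▸ hg.1 l')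
  rw [← hl', this]

/-- If the labels overlap the event is empty. Otherwise the remaining `n - 2k` points avoid both
boxes, and `1 - 2q ≤ (1 - q)²` compares this with independence; the denominator corrects the
exponents. -/
theorem real_occupied_inter_le {X : Type*} [MeasurableSpace X] {k n : ℕ} (μ : Measure X)
    [IsProbabilityMeasure μ] {Q Q' : Set X} {C C' : Fin k → Set X} (hQ : MeasurableSet Q)
    (hQ' : MeasurableSet Q') (hC : ∀ l, MeasurableSet (C l)) (hC' : ∀ l, MeasurableSet (C' l))
    (hCQ : ∀ l, C l ⊆ Q) (hCQ' : ∀ l, C' l ⊆ Q') (hd : Disjoint Q Q') {q s : ℝ}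
    (hq : μ.real Q = q) (hq' : μ.real Q' = q) (hs : ∀ l, μ.real (C l) = s)
    (hs' : ∀ l, μ.real (C' l) = s) (hq1 : q < 1) (f g : Fin k ↪ Fin n) :
    (Measure.pi fun _ : Fin n => μ).real (occupied Q C f ∩ occupied Q' C' g) ≤
      (s ^ k * (1 - q) ^ (n - k)) ^ 2 / (1 - q) ^ (2 * k) := by
  have hq1' : 0 < 1 - q := by linarith
  rcases Set.eq_empty_or_nonempty (occupied Q C f ∩ occupied Q' C' g) with h0 | ⟨x, hf, hg⟩
  · rw [h0, measureReal_empty]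
    positivity
  have hfg (l l' : Fin k) : f l ≠ g l' := by
    intro h
    exact Set.disjoint_left.1 hd (hCQ l (hf.1 l)) (h ▸ hCQ' l' (hg.1 l'))
  let F : Fin k ⊕ Fin k ↪ Fin n :=
    ⟨Sum.elim f g, Function.Injective.sumElim f.injective g.injective hfg⟩
  have hkn : k + k ≤ n := by
    have := Fintype.card_le_of_embedding F
    simpa using this
  have hsub : occupied Q C f ∩ occupied Q' C' g ⊆
      {x | (∀ l, x (F l) ∈ Sum.elim C C' l) ∧ ∀ i ∉ Set.range F, x i ∈ (Q ∪ Q')ᶜ} := by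
    rintro x ⟨hf, hg⟩
    refine ⟨?_, fun i hi => ?_⟩
    · rintro (l | l)
      · exact hf.1 l
      · exact hg.1 l
    · rw [Set.compl_union]
      refine ⟨hf.2 i ?_, hg.2 i ?_⟩
      · rintro ⟨l, rfl⟩; exact hi ⟨.inl l, rfl⟩
      · rintro ⟨l, rfl⟩; exact hi ⟨.inr l, rfl⟩
  refine (measureReal_mono hsub).trans ?_
  rw [pi_embedding_eq μ F (by rintro (l | l); exacts [hC l, hC' l]) (hQ.union hQ').compl,
    Fintype.prod_sum_type, probReal_compl_eq_one_sub (hQ.union hQ'),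
    measureReal_union hd hQ', hq, hq']
  have h2q : 0 ≤ 1 - (q + q) := by
    have h1 : μ.real (Q ∪ Q') ≤ 1 := measureReal_le_one
    rw [measureReal_union hd hQ', hq, hq'] at h1
    linarith
  simp only [Sum.elim_inl, Sum.elim_inr, hs, hs', Finset.prod_const, Finset.card_univ,
    Fintype.card_fin, Fintype.card_sum]
  rw [le_div_iff₀ (by positivity)]
  calc s ^ k * s ^ k * (1 - (q + q)) ^ (n - (k + k)) * (1 - q) ^ (2 * k)
      ≤ s ^ k * s ^ k * ((1 - q) ^ 2) ^ (n - (k + k)) * (1 - q) ^ (2 * k) := by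
        have hs0 : 0 ≤ s ^ k * s ^ k := mul_self_nonneg _
        gcongr
        nlinarith [sq_nonneg q]
    _ = (s ^ k * (1 - q) ^ (n - k)) ^ 2 := by
        obtain ⟨d, rfl⟩ : ∃ d, n = k + k + d := ⟨n - (k + k), by omega⟩
        rw [show k + k + d - (k + k) = d by omega, show k + k + d - k = k + d by omega]
        generalize 1 - q = y
        ring

theorem real_not_occupied_le {X J : Type*} [MeasurableSpace X] [Fintype J] {k n : ℕ}
    (μ : Measure X) [IsProbabilityMeasure μ] {Q : J → Set X} {C : J → Fin k → Set X}
    (hQ : ∀ j, MeasurableSet (Q j)) (hC : ∀ j l, MeasurableSet (C j l))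
    (hCQ : ∀ j l, C j l ⊆ Q j) (hQd : Pairwise (Function.onFun Disjoint Q))
    (hCd : ∀ j, Pairwise (Function.onFun Disjoint (C j))) {q s : ℝ}
    (hq : ∀ j, μ.real (Q j) = q) (hs : ∀ j l, μ.real (C j l) = s) (hq1 : q < 1) {e : ℝ}
    (he : Fintype.card J * (n.descFactorial k : ℝ) * (s ^ k * (1 - q) ^ (n - k)) = e)
    (hpos : 0 < e) :
    (Measure.pi fun _ : Fin n => μ).real
        (⋂ p : J × (Fin k ↪ Fin n), (occupied (Q p.1) (C p.1) p.2)ᶜ) ≤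
      1 / e + (1 / (1 - q) ^ (2 * k) - 1) := by
  classical
  have hq1' : 0 < 1 - q := by linarith
  set P := Measure.pi fun _ : Fin n => μ
  set a := s ^ k * (1 - q) ^ (n - k) with ha
  have hPa (p : J × (Fin k ↪ Fin n)) : P.real (occupied (Q p.1) (C p.1) p.2) = a := by
    rw [occupied, pi_embedding_eq μ p.2 (hC p.1) (hQ p.1).compl,
      probReal_compl_eq_one_sub (hQ p.1), hq]
    simp [hs, ha]
  have hcard : (Fintype.card (J × (Fin k ↪ Fin n)) : ℝ) =
      Fintype.card J * (n.descFactorial k : ℝ) := by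
    rw [Fintype.card_prod, Fintype.card_embedding_eq]
    simp
  have hsum : ∑ p : J × (Fin k ↪ Fin n), P.real (occupied (Q p.1) (C p.1) p.2) = e := by
    simp only [hPa, Finset.sum_const, Finset.card_univ, nsmul_eq_mul]
    rw [hcard, he]
  -- Equal pairs contribute `a`, different labellings of one box contribute nothing, and different
  -- boxes are almost independent.
  have hpair (p p' : J × (Fin k ↪ Fin n)) :
      P.real (occupied (Q p.1) (C p.1) p.2 ∩ occupied (Q p'.1) (C p'.1) p'.2) ≤
        (if p = p' then a else 0) + a ^ 2 / (1 - q) ^ (2 * k) := by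
    have h0 : 0 ≤ a ^ 2 / (1 - q) ^ (2 * k) := by positivity
    by_cases hpp : p = p'
    · subst hpp
      rw [Set.inter_self, hPa, if_pos rfl]
      linarith
    rw [if_neg hpp, zero_add]
    by_cases hj : p.1 = p'.1
    · have hf : p.2 ≠ p'.2 := fun h => hpp (Prod.ext hj h)
      rw [← hj, occupied_inter_eq_empty (hCQ p.1) (hCd p.1) hf, measureReal_empty]
      exact h0
    · exact real_occupied_inter_le μ (hQ _) (hQ _) (hC _) (hC _) (hCQ _) (hCQ _) (hQd hj) (hq _)
        (hq _) (hs _) (hs _) hq1 _ _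
  have hsum2 : ∑ p : J × (Fin k ↪ Fin n), ∑ p' : J × (Fin k ↪ Fin n),
      P.real (occupied (Q p.1) (C p.1) p.2 ∩ occupied (Q p'.1) (C p'.1) p'.2) ≤
        e + e ^ 2 / (1 - q) ^ (2 * k) := by
    refine (Finset.sum_le_sum fun p _ => Finset.sum_le_sum fun p' _ => hpair p p').trans
      (le_of_eq ?_)
    simp only [Finset.sum_add_distrib, Finset.sum_ite_eq, Finset.mem_univ, if_true,
      Finset.sum_const, Finset.card_univ, nsmul_eq_mul]
    rw [hcard, ← he]
    ring
  have hmain := measureReal_iInter_compl_le P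
    (A := fun p : J × (Fin k ↪ Fin n) => occupied (Q p.1) (C p.1) p.2)
    (fun p => measurableSet_occupied (hQ p.1) (hC p.1) p.2) hsum hpos hsum2
  refine hmain.trans (le_of_eq ?_)
  have hy : 0 < (1 - q) ^ (2 * k) := by positivity
  generalize (1 - q) ^ (2 * k) = y at hy ⊢
  field_simp
  ring

/-! ### Boxes and cells along a parabola -/

/-- The half-open square with lower left corner `(x, y)` and side `h`. -/
def halfOpenBox (x y h : ℝ) : Set Plane :=
  {v | v 0 ∈ Set.Ico x (x + h) ∧ v 1 ∈ Set.Ico y (y + h)}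

theorem measurableSet_halfOpenBox (x y h : ℝ) : MeasurableSet (halfOpenBox x y h) := by
  have h0 : Measurable fun v : Plane => v 0 := by fun_prop
  have h1 : Measurable fun v : Plane => v 1 := by fun_prop
  exact (h0 measurableSet_Ico).inter (h1 measurableSet_Ico)

theorem convex_halfOpenBox (x y h : ℝ) : Convex ℝ (halfOpenBox x y h) := by
  have key (i : Fin 2) (z : ℝ) : Convex ℝ {v : Plane | v i ∈ Set.Ico z (z + h)} :=
    (convex_Ico z (z + h)).is_linear_preimage (f := fun v : Plane => v i)
      ⟨fun _ _ => rfl, fun _ _ => rfl⟩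
  exact (key 0 x).inter (key 1 y)

theorem volume_halfOpenBox (x y : ℝ) {h : ℝ} (hh : 0 ≤ h) :
    volume (halfOpenBox x y h) = ENNReal.ofReal (h ^ 2) := by
  have mp := (volume_preserving_finTwoArrow ℝ).comp (PiLp.volume_preserving_ofLp (Fin 2))
  have e : halfOpenBox x y h =
      (MeasurableEquiv.finTwoArrow ∘ fun v : Plane => WithLp.ofLp v) ⁻¹'
        (Set.Ico x (x + h) ×ˢ Set.Ico y (y + h)) := rfl
  rw [e]
  refine (mp.measure_preimage
    (measurableSet_Ico.prod measurableSet_Ico).nullMeasurableSet).trans ?_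
  rw [Measure.volume_eq_prod, Measure.prod_prod, Real.volume_Ico, Real.volume_Ico,
    add_sub_cancel_left, add_sub_cancel_left, ← ENNReal.ofReal_mul hh, sq]

/-- A small box at the point `(l / k, (l / k)²)` of the parabola, in the coordinates of the box
with corner `(x, y)` and side `h`. -/
noncomputable def parabolaCell (x y h : ℝ) (k : ℕ) (l : Fin k) : Set Plane :=
  halfOpenBox (x + h * ((l : ℝ) / k)) (y + h * ((l : ℝ) / k) ^ 2) (h / (4 * (k : ℝ) ^ 2))

theorem div_add_le_one {k : ℕ} (l : Fin k) : (l : ℝ) / k + 1 / (4 * (k : ℝ) ^ 2) ≤ 1 := by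
  have hk : 1 ≤ (k : ℝ) := by exact_mod_cast (Nat.one_le_of_lt l.2)
  have hl : (l : ℝ) + 1 ≤ k := by exact_mod_cast l.2
  have : (1 : ℝ) / (4 * (k : ℝ) ^ 2) ≤ 1 / k := by
    apply one_div_le_one_div_of_le (by linarith)
    nlinarith
  have h2 : (l : ℝ) / k + 1 / k ≤ 1 := by
    rw [← add_div, div_le_one (by linarith)]; exact hl
  linarith

theorem parabolaCell_subset (x y : ℝ) {h : ℝ} (hh : 0 < h) (k : ℕ) (l : Fin k) :
    parabolaCell x y h k l ⊆ halfOpenBox x y h := by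
  rintro v ⟨⟨a1, a2⟩, b1, b2⟩
  have h1 := div_add_le_one l
  set t := (l : ℝ) / k with ht
  have ht0 : 0 ≤ t := by positivity
  have ht1 : t ≤ 1 := by
    have : (0 : ℝ) ≤ 1 / (4 * (k : ℝ) ^ 2) := by positivity
    linarith
  have e : h / (4 * (k : ℝ) ^ 2) = h * (1 / (4 * (k : ℝ) ^ 2)) := by ring
  rw [e] at a2 b2
  have hle : h * t + h * (1 / (4 * (k : ℝ) ^ 2)) ≤ h := by
    rw [← mul_add]
    exact mul_le_of_le_one_right hh.le h1
  have hsq : h * t ^ 2 ≤ h * t := by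
    have : t ^ 2 ≤ t := by nlinarith
    gcongr
  have p1 : 0 ≤ h * t := by positivity
  have p2 : 0 ≤ h * t ^ 2 := by positivity
  exact ⟨⟨by linarith, by linarith⟩, by linarith, by linarith⟩

theorem one_div_sq_le_sub_sq {k : ℕ} {i j : Fin k} (hij : i ≠ j) :
    1 / (k : ℝ) ^ 2 ≤ ((j : ℝ) / k - (i : ℝ) / k) ^ 2 := by
  have hk : 0 < (k : ℝ) := by exact_mod_cast i.pos
  rw [← sub_div, div_pow]
  gcongr
  have : (1 : ℤ) ≤ ((j : ℤ) - (i : ℤ)) ^ 2 := by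
    have hne : ((j : ℤ) - (i : ℤ)) ≠ 0 := by
      intro h
      apply hij
      ext
      omega
    have := sq_pos_of_ne_zero hne
    omega
  exact_mod_cast this

/-- The deviation of `v` from the tangent of the parabola at abscissa `t`. -/
def tangentGap (x y h t : ℝ) (v : Plane) : ℝ := (v 1 - y) - 2 * t * (v 0 - x) + h * t ^ 2

theorem convex_tangentGap_ge (x y h t r : ℝ) : Convex ℝ {v | r ≤ tangentGap x y h t v} := by
  have hl : IsLinearMap ℝ fun v : Plane => v 1 - 2 * t * v 0 :=
    ⟨fun v w => by simp; ring, fun c v => by simp; ring⟩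
  have e : {v | r ≤ tangentGap x y h t v} =
      {v : Plane | r + y - 2 * t * x - h * t ^ 2 ≤ v 1 - 2 * t * v 0} := by
    ext v
    simp only [Set.mem_ofPred_eq, tangentGap]
    constructor <;> intro H <;> linarith
  rw [e]
  exact convex_halfSpace_ge hl _

theorem tangentGap_lt {x y h : ℝ} {k : ℕ} {l : Fin k} {v : Plane}
    (hv : v ∈ parabolaCell x y h k l) :
    tangentGap x y h ((l : ℝ) / k) v < h / (4 * (k : ℝ) ^ 2) := by
  obtain ⟨⟨a1, a2⟩, b1, b2⟩ := hv
  have ht0 : 0 ≤ (l : ℝ) / k := by positivity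
  set t := (l : ℝ) / k
  unfold tangentGap
  nlinarith [mul_le_mul_of_nonneg_left a1 ht0]

/-- At the corner of cell `j` the gap to tangent `i` is `h (t' - t)² ≥ h / k² = 4ε`, with `ε` the
side of the cell. Moving within the cell loses at most `2ε`, as the slope `2t` is at most 2. In cell
`i` itself the gap stays below `ε`, so the side `h / (4k²)` separates the cells. -/
theorem le_tangentGap {x y h : ℝ} (hh : 0 < h) {k : ℕ} {i j : Fin k} (hij : i ≠ j) {v : Plane}
    (hv : v ∈ parabolaCell x y h k j) :
    2 * (h / (4 * (k : ℝ) ^ 2)) ≤ tangentGap x y h ((i : ℝ) / k) v := by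
  obtain ⟨⟨a1, a2⟩, b1, b2⟩ := hv
  have h0 : (0 : ℝ) ≤ (i : ℝ) / k := by positivity
  have h1 : (i : ℝ) / k ≤ 1 := by
    have := div_add_le_one i
    have : (0 : ℝ) ≤ 1 / (4 * (k : ℝ) ^ 2) := by positivity
    linarith
  have hsq := mul_le_mul_of_nonneg_left (one_div_sq_le_sub_sq hij) hh.le
  have e : h * (1 / (k : ℝ) ^ 2) = 4 * (h / (4 * (k : ℝ) ^ 2)) := by ring
  have hpos : 0 ≤ h / (4 * (k : ℝ) ^ 2) := by positivity
  rw [e] at hsq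
  set ε := h / (4 * (k : ℝ) ^ 2)
  set t := (i : ℝ) / k
  set t' := (j : ℝ) / k
  unfold tangentGap
  have h3 := mul_le_mul_of_nonneg_left a2.le h0
  have h4 := mul_le_of_le_one_left hpos h1
  nlinarith

theorem disjoint_parabolaCell {x y h : ℝ} (hh : 0 < h) (k : ℕ) :
    Pairwise (Function.onFun Disjoint (parabolaCell x y h k)) := by
  intro i j hij
  rw [Function.onFun, Set.disjoint_left]
  intro v hi hj
  have h1 := tangentGap_lt hi
  have h2 := le_tangentGap hh hij hj
  have hk : 0 < (k : ℝ) := by exact_mod_cast i.pos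
  have hpos : 0 < h / (4 * (k : ℝ) ^ 2) := by positivity
  linarith

/-- A small step downwards would lower the gap. -/
theorem notMem_interior_of_tangentGap_le {x y h t : ℝ} {K : Set Plane} {v : Plane}
    (hK : ∀ w ∈ K, tangentGap x y h t v ≤ tangentGap x y h t w) : v ∉ interior K := by
  intro hv
  have hc : Continuous fun δ : ℝ => v - δ • (EuclideanSpace.single 1 1 : Plane) := by fun_prop
  have hev : ∀ᶠ δ in 𝓝 (0 : ℝ), v - δ • (EuclideanSpace.single 1 1 : Plane) ∈ interior K :=
    hc.continuousAt.eventually_mem (isOpen_interior.mem_nhds (by simpa using hv))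
  obtain ⟨δ, hδ, hpos⟩ := ((hev.filter_mono nhdsWithin_le_nhds).and
    (self_mem_nhdsWithin : Set.Ioi (0 : ℝ) ∈ 𝓝[>] 0)).exists
  have h1 := hK _ (interior_subset hδ)
  have hpos' : 0 < δ := hpos
  simp [tangentGap] at h1
  linarith

/-- Each chosen point is the strict minimum of its own tangent gap, which gives convex position and
keeps it off the interior. All other points lie outside the convex box. -/
theorem le_hol_of_occupied {n k : ℕ} (hk : 3 ≤ k) {x y h : ℝ} (hh : 0 < h) {f : Fin k ↪ Fin n}
    {p : Fin n → Plane} (hp : p ∈ occupied (halfOpenBox x y h) (parabolaCell x y h k) f) :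
    k ≤ hol (pointSet p) := by
  classical
  obtain ⟨hin, hout⟩ := hp
  have hεpos : 0 < h / (4 * (k : ℝ) ^ 2) := by
    have : 0 < (k : ℝ) := by exact_mod_cast (by omega : 0 < k)
    positivity
  rw [le_hol_iff (by omega), exists_isConvexHole_pointSet_iff]
  have hsub : p '' ((Finset.univ.map f : Finset (Fin n)) : Set (Fin n)) ⊆ halfOpenBox x y h := by
    rintro _ ⟨i, hi, rfl⟩
    obtain ⟨l, -, rfl⟩ := Finset.mem_map.1 hi
    exact parabolaCell_subset x y hh k l (hin l)
  refine ⟨Finset.univ.map f, by simpa using hk, fun i hi hmem => ?_, fun i hmem => ?_⟩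
  · obtain ⟨l, -, rfl⟩ := Finset.mem_map.1 hi
    have h1 : convexHull ℝ (p '' (((Finset.univ.map f : Finset (Fin n)) : Set (Fin n)) \ {f l})) ⊆
        {v | 2 * (h / (4 * (k : ℝ) ^ 2)) ≤ tangentGap x y h ((l : ℝ) / k) v} := by
      refine convexHull_min ?_ (convex_tangentGap_ge _ _ _ _ _)
      rintro _ ⟨i, ⟨hi, hne⟩, rfl⟩
      obtain ⟨l', -, rfl⟩ := Finset.mem_map.1 hi
      exact le_tangentGap hh (fun e => hne (by rw [e]; rfl)) (hin l')
    have h2 : 2 * (h / (4 * (k : ℝ) ^ 2)) ≤ tangentGap x y h ((l : ℝ) / k) (p (f l)) := h1 hmem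
    have h3 := tangentGap_lt (hin l)
    linarith
  · by_cases hi : i ∈ Set.range f
    · obtain ⟨l, rfl⟩ := hi
      refine notMem_interior_of_tangentGap_le (x := x) (y := y) (h := h) (t := (l : ℝ) / k) ?_ hmem
      refine fun w hw => convexHull_min (s := p '' _) ?_
        (convex_tangentGap_ge x y h ((l : ℝ) / k) (tangentGap x y h ((l : ℝ) / k) (p (f l)))) hw
      rintro _ ⟨i, hi, rfl⟩
      obtain ⟨l', -, rfl⟩ := Finset.mem_map.1 hi
      change tangentGap x y h ((l : ℝ) / k) (p (f l)) ≤ tangentGap x y h ((l : ℝ) / k) (p (f l'))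
      by_cases hll : l = l'
      · rw [hll]
      · have h2 := le_tangentGap hh hll (hin l')
        have h3 := tangentGap_lt (hin l)
        linarith
    · exact hout i hi (convexHull_min hsub (convex_halfOpenBox x y h) (interior_subset hmem))

/-! ### A grid of boxes in a region -/

theorem exists_halfOpenBox_subset {R : Set Plane} (hint : (interior R).Nonempty) :
    ∃ x y L : ℝ, 0 < L ∧ halfOpenBox x y L ⊆ R := by
  obtain ⟨c, hc⟩ := hint
  obtain ⟨r, hr, hball⟩ := Metric.mem_nhds_iff.1 (mem_interior_iff_mem_nhds.1 hc)
  refine ⟨c 0, c 1, r / 2, by positivity, fun v hv => hball ?_⟩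
  obtain ⟨⟨a1, a2⟩, b1, b2⟩ := hv
  rw [Metric.mem_ball, EuclideanSpace.dist_eq, Real.sqrt_lt' hr, Fin.sum_univ_two,
    Real.dist_eq, Real.dist_eq, sq_abs, sq_abs]
  nlinarith

/-- The boxes of the `M × M` grid in the box with corner `(x, y)` and side `M * h`. -/
def gridBox (x y h : ℝ) {M : ℕ} (j : Fin M × Fin M) : Set Plane :=
  halfOpenBox (x + h * (j.1 : ℕ)) (y + h * (j.2 : ℕ)) h

theorem gridBox_subset (x y : ℝ) {h : ℝ} (hh : 0 < h) {M : ℕ} (j : Fin M × Fin M) :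
    gridBox x y h j ⊆ halfOpenBox x y (M * h) := by
  rintro v ⟨⟨a1, a2⟩, b1, b2⟩
  have key (i : Fin M) : 0 ≤ h * (i : ℕ) ∧ h * (i : ℕ) + h ≤ M * h := by
    refine ⟨by positivity, ?_⟩
    have : ((i : ℕ) : ℝ) + 1 ≤ M := by exact_mod_cast i.2
    nlinarith
  have k1 := key j.1
  have k2 := key j.2
  exact ⟨⟨by linarith, by linarith⟩, by linarith, by linarith⟩

theorem eq_of_mem_Ico_grid {z h u : ℝ} (hh : 0 < h) {i j : ℕ}
    (hi : u ∈ Set.Ico (z + h * i) (z + h * i + h)) (hj : u ∈ Set.Ico (z + h * j) (z + h * j + h)) :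
    i = j := by
  have key {i j : ℕ} (hi : u ∈ Set.Ico (z + h * i) (z + h * i + h))
      (hj : u ∈ Set.Ico (z + h * j) (z + h * j + h)) : i ≤ j := by
    have h1 : h * i < h * (j + 1) := by linarith [hi.1, hj.2]
    have h2 : (i : ℝ) < j + 1 := lt_of_mul_lt_mul_left h1 hh.le
    have h3 : i < j + 1 := by exact_mod_cast h2
    omega
  exact le_antisymm (key hi hj) (key hj hi)

theorem disjoint_gridBox (x y : ℝ) {h : ℝ} (hh : 0 < h) (M : ℕ) :
    Pairwise (Function.onFun Disjoint (gridBox x y h (M := M))) := by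
  intro i j hij
  rw [Function.onFun, Set.disjoint_left]
  intro v hi hj
  exact hij (Prod.ext (Fin.ext (eq_of_mem_Ico_grid hh hi.1 hj.1))
    (Fin.ext (eq_of_mem_Ico_grid hh hi.2 hj.2)))

theorem cond_real_halfOpenBox {R : Set Plane} {x y h : ℝ} (hh : 0 ≤ h)
    (hsub : halfOpenBox x y h ⊆ R) :
    (ProbabilityTheory.cond (volume : Measure Plane) R).real (halfOpenBox x y h) =
      h ^ 2 / (volume R).toReal := by
  rw [Measure.real, cond_apply_of_subset (measurableSet_halfOpenBox x y h) hsub,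
    volume_halfOpenBox x y hh, ENNReal.toReal_mul, ENNReal.toReal_inv,
    ENNReal.toReal_ofReal (by positivity)]
  ring

theorem uniformPoints_real_hol_lt_le_of_grid {R : Set Plane} (hbdd : Bornology.IsBounded R)
    (hint : (interior R).Nonempty) {x y L : ℝ} (hL : 0 < L) (hsub : halfOpenBox x y L ⊆ R)
    {n k M : ℕ} (hk : 3 ≤ k) (hM : 0 < M) {q e : ℝ}
    (hq : L ^ 2 / (volume R).toReal / (M : ℝ) ^ 2 = q) (hq1 : q < 1)
    (he : (M : ℝ) ^ 2 * (n.descFactorial k : ℝ) *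
      ((q / (16 * (k : ℝ) ^ 4)) ^ k * (1 - q) ^ (n - k)) = e) (hpos : 0 < e) :
    (uniformPoints R n).real {p | hol (pointSet p) < k} ≤
      1 / e + (1 / (1 - q) ^ (2 * k) - 1) := by
  have := isProbabilityMeasure_cond hbdd hint
  set μ := ProbabilityTheory.cond (volume : Measure Plane) R with hμ
  have hM' : (0 : ℝ) < M := by exact_mod_cast hM
  have hk' : (0 : ℝ) < k := by exact_mod_cast (by omega : 0 < k)
  set h := L / M with hh
  have hhpos : 0 < h := by positivity
  have hMh : M * h = L := by rw [hh]; field_simp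
  have hgrid (j : Fin M × Fin M) : gridBox x y h j ⊆ R := by
    have := gridBox_subset x y hhpos j
    rw [hMh] at this
    exact this.trans hsub
  let C (j : Fin M × Fin M) : Fin k → Set Plane :=
    parabolaCell (x + h * (j.1 : ℕ)) (y + h * (j.2 : ℕ)) h k
  have hCQ (j : Fin M × Fin M) (l : Fin k) : C j l ⊆ gridBox x y h j :=
    parabolaCell_subset _ _ hhpos k l
  have hqQ (j : Fin M × Fin M) : μ.real (gridBox x y h j) = q := by
    rw [gridBox, cond_real_halfOpenBox hhpos.le (hgrid j), ← hq, hh]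
    ring
  have hsC (j : Fin M × Fin M) (l : Fin k) : μ.real (C j l) = q / (16 * (k : ℝ) ^ 4) := by
    have := cond_real_halfOpenBox (R := R) (x := x + h * (j.1 : ℕ) + h * ((l : ℝ) / k))
      (y := y + h * (j.2 : ℕ) + h * ((l : ℝ) / k) ^ 2) (h := h / (4 * (k : ℝ) ^ 2)) (by positivity)
      ((hCQ j l).trans (hgrid j))
    refine this.trans ?_
    rw [← hq, hh]
    ring
  have key := real_not_occupied_le μ (Q := gridBox x y h (M := M)) (C := C) (n := n)
    (fun j => measurableSet_halfOpenBox _ _ _) (fun j l => measurableSet_halfOpenBox _ _ _) hCQ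
    (disjoint_gridBox x y hhpos M) (fun j => disjoint_parabolaCell hhpos k) hqQ hsC hq1
    (by rw [← he]; simp [sq]) hpos
  have hset : {p : Fin n → Plane | hol (pointSet p) < k} ⊆
      ⋂ p : (Fin M × Fin M) × (Fin k ↪ Fin n), (occupied (gridBox x y h p.1) (C p.1) p.2)ᶜ := by
    intro p hp
    refine Set.mem_iInter.2 fun jf hocc => ?_
    have h1 : hol (pointSet p) < k := hp
    have h2 := le_hol_of_occupied hk hhpos hocc
    omega
  exact (measureReal_mono (μ := Measure.pi fun _ => μ) hset).trans key

/-! ### Tail bounds for the size of the largest hole -/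

theorem exp_neg_two_mul_le {q : ℝ} (h0 : 0 ≤ q) (h1 : q ≤ 1 / 2) :
    Real.exp (-(2 * q)) ≤ 1 - q := by
  have hpos : 0 < 1 - q := by linarith
  rw [← Real.le_log_iff_exp_le hpos]
  refine le_trans ?_ (Real.one_sub_inv_le_log_of_pos hpos)
  have : (1 - q)⁻¹ ≤ 1 + 2 * q := by
    rw [inv_le_iff_one_le_mul₀ hpos]
    nlinarith
  linarith

theorem exists_uniformPoints_real_hol_lt_le {R : Set Plane} (hbdd : Bornology.IsBounded R)
    (hint : (interior R).Nonempty) :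
    ∃ c₀ : ℝ, 0 < c₀ ∧ ∀ n k : ℕ, 3 ≤ k → 2 * k ≤ n →
      (uniformPoints R n).real {p | hol (pointSet p) < k} ≤
        4 * Real.exp 8 * (32 / c₀ * (k : ℝ) ^ 4) ^ k / n + (Real.exp (16 * k / n) - 1) := by
  have := isProbabilityMeasure_cond hbdd hint
  obtain ⟨x, y, L, hL, hsub⟩ := exists_halfOpenBox_subset hint
  have hV : 0 < (volume R).toReal :=
    ENNReal.toReal_pos (volume_ne_zero_of_interior hint) hbdd.measure_lt_top.ne
  set c₀ := L ^ 2 / (volume R).toReal with hc₀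
  have hc0 : 0 < c₀ := by positivity
  have hc1 : c₀ ≤ 1 := by
    rw [hc₀, ← cond_real_halfOpenBox hL.le hsub]
    exact measureReal_le_one
  refine ⟨c₀, hc0, fun n k hk hkn => ?_⟩
  -- About `n` boxes, so that `c₀ ≤ n q ≤ 4`: a box expects a bounded number of points.
  set M := Nat.sqrt n with hMdef
  have hM2 : 2 ≤ M := Nat.le_sqrt.2 (by omega)
  have hMn : M * M ≤ n := Nat.sqrt_le n
  have hnM : n ≤ 4 * (M * M) := by
    have : n < (M + 1) * (M + 1) := Nat.lt_succ_sqrt n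
    nlinarith
  have hMr : (2 : ℝ) ≤ M := by exact_mod_cast hM2
  have hn0 : (0 : ℝ) < n := by exact_mod_cast (by omega : 0 < n)
  have hk0 : (0 : ℝ) < k := by exact_mod_cast (by omega : 0 < k)
  have hMn' : (M : ℝ) ^ 2 ≤ n := by rw [sq]; exact_mod_cast hMn
  have hnM' : (n : ℝ) ≤ 4 * (M : ℝ) ^ 2 := by rw [sq]; exact_mod_cast hnM
  set q := c₀ / (M : ℝ) ^ 2 with hq
  have hq0 : 0 < q := by positivity
  have hq4 : q ≤ 4 / n := by
    rw [hq, div_le_div_iff₀ (by positivity) hn0]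
    nlinarith
  have hnq : c₀ ≤ n * q := by
    rw [hq, mul_div_assoc', le_div_iff₀ (by positivity)]
    nlinarith
  have hqh : q ≤ 1 / 2 := by
    rw [hq, div_le_div_iff₀ (by positivity) (by norm_num)]
    nlinarith
  have hqexp := exp_neg_two_mul_le hq0.le hqh
  have hqpos : 0 < 1 - q := by linarith
  set e := (M : ℝ) ^ 2 * (n.descFactorial k : ℝ) *
      ((q / (16 * (k : ℝ) ^ 4)) ^ k * (1 - q) ^ (n - k)) with he
  have hdesc : ((n : ℝ) / 2) ^ k ≤ n.descFactorial k := by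
    have h1 : (n + 1 - k) ^ k ≤ n.descFactorial k := Nat.pow_sub_le_descFactorial n k
    have h2 : (n : ℝ) / 2 ≤ ((n + 1 - k : ℕ) : ℝ) := by
      rw [div_le_iff₀ (by norm_num)]
      exact_mod_cast (by omega : n ≤ (n + 1 - k) * 2)
    calc ((n : ℝ) / 2) ^ k ≤ ((n + 1 - k : ℕ) : ℝ) ^ k := by gcongr
      _ ≤ _ := by exact_mod_cast h1
  -- Here `n / 4` bounds the number of boxes, the labellings number at least `(n / 2)^k`, and `exp
  -- (-8)` bounds the emptiness factor because `2 n q ≤ 8`.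
  have hmain : (n : ℝ) / 4 * (c₀ / (32 * (k : ℝ) ^ 4)) ^ k * Real.exp (-8) ≤ e := by
    have h1 : (c₀ / (32 * (k : ℝ) ^ 4)) ^ k ≤
        (n.descFactorial k : ℝ) * (q / (16 * (k : ℝ) ^ 4)) ^ k := by
      calc (c₀ / (32 * (k : ℝ) ^ 4)) ^ k ≤ ((n : ℝ) / 2 * (q / (16 * (k : ℝ) ^ 4))) ^ k := by
            have : (n : ℝ) / 2 * (q / (16 * (k : ℝ) ^ 4)) = n * q / (32 * (k : ℝ) ^ 4) := by ring
            rw [this]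
            gcongr
        _ = ((n : ℝ) / 2) ^ k * (q / (16 * (k : ℝ) ^ 4)) ^ k := mul_pow _ _ _
        _ ≤ _ := by gcongr
    have h2 : Real.exp (-8) ≤ (1 - q) ^ (n - k) := by
      calc Real.exp (-8) ≤ Real.exp (n * (-(2 * q))) := by
            rw [Real.exp_le_exp]
            rw [le_div_iff₀ hn0] at hq4
            nlinarith
        _ = Real.exp (-(2 * q)) ^ n := Real.exp_nat_mul _ _
        _ ≤ (1 - q) ^ n := by gcongr
        _ ≤ (1 - q) ^ (n - k) := pow_le_pow_of_le_one hqpos.le (by linarith) (Nat.sub_le _ _)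
    calc (n : ℝ) / 4 * (c₀ / (32 * (k : ℝ) ^ 4)) ^ k * Real.exp (-8)
        ≤ (M : ℝ) ^ 2 * ((n.descFactorial k : ℝ) * (q / (16 * (k : ℝ) ^ 4)) ^ k) *
          (1 - q) ^ (n - k) := by
          gcongr
          linarith
      _ = e := by rw [he]; ring
  have hlow : 0 < (n : ℝ) / 4 * (c₀ / (32 * (k : ℝ) ^ 4)) ^ k * Real.exp (-8) := by positivity
  have hpos : 0 < e := hlow.trans_le hmain
  refine (uniformPoints_real_hol_lt_le_of_grid hbdd hint hL hsub hk (by omega) hq.symm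
    (by linarith) he.symm hpos).trans ?_
  refine add_le_add ?_ (sub_le_sub_right ?_ 1)
  · refine (one_div_le_one_div_of_le hlow hmain).trans (le_of_eq ?_)
    rw [Real.exp_neg, show 32 / c₀ * (k : ℝ) ^ 4 = (c₀ / (32 * (k : ℝ) ^ 4))⁻¹ by
      rw [inv_div]; ring, inv_pow]
    field_simp
  · calc 1 / (1 - q) ^ (2 * k) ≤ 1 / Real.exp (-(2 * q)) ^ (2 * k) := by gcongr
      _ = Real.exp (4 * k * q) := by
          rw [← Real.exp_nat_mul, one_div, ← Real.exp_neg]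
          congr 1
          push_cast
          ring
      _ ≤ Real.exp (16 * k / n) := by
          rw [Real.exp_le_exp]
          calc 4 * (k : ℝ) * q ≤ 4 * k * (4 / n) := by gcongr
            _ = 16 * k / n := by ring

theorem sq_div_two_le_exp {t : ℝ} (ht : 0 ≤ t) : t ^ 2 / 2 ≤ Real.exp t := by
  simpa using Real.pow_div_factorial_le_exp t ht 2

/-- A weak Stirling bound: `m ^ m / m!` is a term of the series of `exp m`. -/
theorem pow_div_factorial_le_exp_neg {m : ℕ} (hm : 0 < m) {t : ℝ}
    (h : 32 * Real.exp 1 * Real.exp t ≤ m) :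
    (32 : ℝ) ^ m / m.factorial ≤ Real.exp (-(m * t)) := by
  have hm' : (0 : ℝ) < m := by exact_mod_cast hm
  have h1 := Real.pow_div_factorial_le_exp (m : ℝ) hm'.le m
  have h2 : (32 * Real.exp 1 * Real.exp t) ^ m / m.factorial ≤ Real.exp m := by
    refine le_trans ?_ h1
    gcongr
  rw [mul_pow, mul_pow, ← Real.exp_nat_mul, ← Real.exp_nat_mul, mul_one] at h2
  have hf : (0 : ℝ) < m.factorial := by exact_mod_cast m.factorial_pos
  rw [Real.exp_neg, ← one_div, le_div_iff₀ (Real.exp_pos _)]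
  have h3 : Real.exp m * (32 ^ m / m.factorial * Real.exp (m * t)) ≤ Real.exp m * 1 := by
    refine le_of_eq_of_le ?_ (h2.trans (mul_one _).ge)
    ring
  exact le_of_mul_le_mul_left h3 (Real.exp_pos _)

theorem uniformPoints_real_hol_gt_le {R : Set Plane} (hconv : Convex ℝ R)
    (hbdd : Bornology.IsBounded R) (hint : (interior R).Nonempty) {n : ℕ}
    (hn : 64 ≤ Real.log (Real.log n)) :
    (uniformPoints R n).real
        {p | 60 * (Real.log n / Real.log (Real.log n)) < (hol (pointSet p) : ℝ)} ≤
      2 * Real.exp (-(3 * Real.log n)) := by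
  set ℓ := Real.log (Real.log n) with hℓ
  set L := Real.log n with hLdef
  -- By convention `Real.log 0 = 0`, so a vanishing `log n` would contradict `64 ≤ log log n`.
  have hL0 : 0 < L := by
    by_contra hneg
    have h0 : 0 ≤ L := Real.log_natCast_nonneg n
    have : L = 0 := le_antisymm (not_lt.1 hneg) h0
    rw [hℓ, this, Real.log_zero] at hn
    linarith
  have hLe : L = Real.exp ℓ := (Real.exp_log hL0).symm
  have hn0 : (0 : ℝ) < n := by
    rcases Nat.eq_zero_or_pos n with h | h
    · rw [hLdef, h] at hL0; simp at hL0
    · exact_mod_cast h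
  have hne : (n : ℝ) = Real.exp L := (Real.exp_log hn0).symm
  have hL2 : ℓ ^ 2 / 2 ≤ L := hLe ▸ sq_div_two_le_exp (by linarith)
  have hL100 : 100 ≤ L := by nlinarith
  set F := L / ℓ with hF
  have hFℓ : F * ℓ = L := div_mul_cancel₀ _ (by linarith)
  have hF32 : 32 ≤ F := by
    rw [hF, le_div_iff₀ (by linarith)]; nlinarith
  have hFL : F ≤ L := div_le_self hL0.le (by linarith)
  -- With `t = ℓ / 2` this gives `m t ≥ 6 L`, so `n³ 32^m / m! ≤ n⁻³`. Moreover `4m + 3 < 48 F + 7 ≤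
  -- 60 F`.
  set m := ⌈12 * F⌉₊ with hm
  have hm1 : 12 * F ≤ m := Nat.le_ceil _
  have hm2 : (m : ℝ) < 12 * F + 1 := Nat.ceil_lt_add_one (by linarith)
  have hm0 : 0 < m := by
    have : (0 : ℝ) < m := by linarith
    exact_mod_cast this
  have hmn : 2 * (m + 3) ≤ n := by
    have h1 : L ^ 2 / 2 ≤ n := hne ▸ sq_div_two_le_exp hL0.le
    have : (2 * (m + 3) : ℝ) ≤ n := by nlinarith
    exact_mod_cast this
  have hexp : 32 * Real.exp 1 * Real.exp (ℓ / 2) ≤ m := by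
    refine le_trans ?_ hm1
    rw [hF, hLe, mul_div_assoc', le_div_iff₀ (by linarith)]
    have h1 : Real.exp ℓ = Real.exp (ℓ / 2) * Real.exp (ℓ / 2) := by
      rw [← Real.exp_add]; ring_nf
    have h2 := sq_div_two_le_exp (t := ℓ / 2) (by linarith)
    have h3 := Real.exp_one_lt_d9
    have h4 : 32 * Real.exp 1 * ℓ ≤ 12 * Real.exp (ℓ / 2) := by nlinarith
    rw [h1]
    nlinarith [Real.exp_pos (ℓ / 2)]
  have hfac := pow_div_factorial_le_exp_neg hm0 hexp
  have hfac' : (32 : ℝ) ^ m / m.factorial ≤ Real.exp (-(6 * L)) := by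
    refine hfac.trans ?_
    rw [Real.exp_le_exp]
    nlinarith
  have hsub : {p : Fin n → Plane | 60 * F < (hol (pointSet p) : ℝ)} ⊆
      {p | 4 * m + 3 ≤ hol (pointSet p)} := by
    intro p hp
    have hp' : 60 * F < (hol (pointSet p) : ℝ) := hp
    have : ((4 * m + 3 : ℕ) : ℝ) ≤ (hol (pointSet p) : ℝ) := by push_cast; linarith
    exact_mod_cast this
  have hb : 0 ≤ 2 * (n : ℝ) ^ 3 * (32 ^ m / m.factorial) := by positivity
  have hmeas := ENNReal.toReal_mono ENNReal.ofReal_ne_top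
    ((measure_mono hsub).trans (uniformPoints_hol_ge_le hconv hbdd hint hmn))
  rw [ENNReal.toReal_ofReal hb] at hmeas
  refine hmeas.trans ?_
  calc 2 * (n : ℝ) ^ 3 * (32 ^ m / m.factorial) ≤ 2 * (n : ℝ) ^ 3 * Real.exp (-(6 * L)) := by
        gcongr
    _ = 2 * Real.exp (-(3 * L)) := by
        rw [hne, ← Real.exp_nat_mul, mul_assoc, ← Real.exp_add]
        congr 2
        push_cast
        ring

theorem exists_uniformPoints_real_hol_lt_le_exp {R : Set Plane} (hbdd : Bornology.IsBounded R)
    (hint : (interior R).Nonempty) :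
    ∃ K : ℝ, 64 ≤ K ∧ ∀ n : ℕ, K ≤ Real.log (Real.log n) →
      (uniformPoints R n).real
          {p | (hol (pointSet p) : ℝ) < 1 / 20 * (Real.log n / Real.log (Real.log n))} ≤
        4 * Real.exp 8 * Real.exp (-(Real.log n / 2)) +
          (Real.exp (16 * (Real.log n * Real.exp (-Real.log n))) - 1) := by
  have := isProbabilityMeasure_cond hbdd hint
  obtain ⟨c₀, hc0, hmain⟩ := exists_uniformPoints_real_hol_lt_le hbdd hint
  -- The second bound makes `32 / c₀ ≤ log n`, so the constant of the region is absorbed into one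
  -- more power of `log n`.
  refine ⟨max 64 (Real.log (32 / c₀)), le_max_left _ _, fun n hK => ?_⟩
  have hn : 64 ≤ Real.log (Real.log n) := (le_max_left _ _).trans hK
  have hK' : Real.log (32 / c₀) ≤ Real.log (Real.log n) := (le_max_right _ _).trans hK
  set ℓ := Real.log (Real.log n) with hℓ
  set L := Real.log n with hLdef
  have hL0 : 0 < L := by
    by_contra hneg
    have h0 : 0 ≤ L := Real.log_natCast_nonneg n
    have : L = 0 := le_antisymm (not_lt.1 hneg) h0
    rw [hℓ, this, Real.log_zero] at hn
    linarith
  have hLe : L = Real.exp ℓ := (Real.exp_log hL0).symm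
  have hn0 : (0 : ℝ) < n := by
    rcases Nat.eq_zero_or_pos n with h | h
    · rw [hLdef, h] at hL0; simp at hL0
    · exact_mod_cast h
  have hne : (n : ℝ) = Real.exp L := (Real.exp_log hn0).symm
  have hL2 : ℓ ^ 2 / 2 ≤ L := hLe ▸ sq_div_two_le_exp (by linarith)
  have hL100 : 100 ≤ L := by nlinarith
  set F := L / ℓ with hF
  have hFℓ : F * ℓ = L := div_mul_cancel₀ _ (by linarith)
  have hFL : F ≤ L := div_le_self hL0.le (by linarith)
  have hF60 : 60 ≤ F := by
    have h3 := Real.pow_div_factorial_le_exp ℓ (by linarith) 3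
    rw [← hLe] at h3
    rw [hF, le_div_iff₀ (by linarith)]
    have : (Nat.factorial 3 : ℝ) = 6 := by norm_num [Nat.factorial]
    rw [this, div_le_iff₀ (by norm_num)] at h3
    nlinarith [sq_nonneg ℓ]
  -- The base `32 / c₀ * k⁴` is at most `exp (5ℓ)`, and `5 k ℓ ≤ L / 2`, so its `k`-th power is at
  -- most `√n`. As `F ≥ 60`, the rounding leaves `k > F / 20`.
  set k := ⌊F / 10⌋₊ with hk
  have hk1 : (k : ℝ) ≤ F / 10 := Nat.floor_le (by linarith)
  have hk2 : F / 10 < k + 1 := Nat.lt_floor_add_one _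
  have hk3 : 3 ≤ k := Nat.le_floor (by push_cast; linarith)
  have hk0 : (0 : ℝ) < k := by exact_mod_cast (by omega : 0 < k)
  have hkn : 2 * k ≤ n := by
    have h1 : L ^ 2 / 2 ≤ n := hne ▸ sq_div_two_le_exp hL0.le
    have : (2 * k : ℝ) ≤ n := by nlinarith
    exact_mod_cast this
  have hsub : {p : Fin n → Plane | (hol (pointSet p) : ℝ) < 1 / 20 * F} ⊆
      {p | hol (pointSet p) < k} := by
    intro p hp
    have hp' : (hol (pointSet p) : ℝ) < 1 / 20 * F := hp
    have : (hol (pointSet p) : ℝ) < k := by linarith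
    exact_mod_cast this
  have : IsProbabilityMeasure (uniformPoints R n) := by unfold uniformPoints; infer_instance
  refine (measureReal_mono hsub).trans ((hmain n k hk3 hkn).trans ?_)
  have hbase : 32 / c₀ * (k : ℝ) ^ 4 ≤ Real.exp (5 * ℓ) := by
    have h1 : 32 / c₀ ≤ Real.exp ℓ := by
      rw [← Real.log_le_iff_le_exp (by positivity)]; exact hK'
    have h2 : (k : ℝ) ≤ Real.exp ℓ := by rw [← hLe]; linarith
    calc 32 / c₀ * (k : ℝ) ^ 4 ≤ Real.exp ℓ * Real.exp ℓ ^ 4 := by gcongr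
      _ = Real.exp (5 * ℓ) := by rw [← Real.exp_nat_mul, ← Real.exp_add]; push_cast; ring_nf
  have hpow : (32 / c₀ * (k : ℝ) ^ 4) ^ k ≤ Real.exp (L / 2) := by
    calc (32 / c₀ * (k : ℝ) ^ 4) ^ k ≤ Real.exp (5 * ℓ) ^ k := by gcongr
      _ = Real.exp (k * (5 * ℓ)) := (Real.exp_nat_mul _ _).symm
      _ ≤ Real.exp (L / 2) := by
          rw [Real.exp_le_exp]
          nlinarith
  refine add_le_add ?_ (sub_le_sub_right ?_ 1)
  · calc 4 * Real.exp 8 * (32 / c₀ * (k : ℝ) ^ 4) ^ k / n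
        ≤ 4 * Real.exp 8 * Real.exp (L / 2) / n := by gcongr
      _ = 4 * Real.exp 8 * Real.exp (-(L / 2)) := by
          rw [hne, mul_div_assoc, ← Real.exp_sub]
          congr 2
          ring
  · rw [Real.exp_le_exp, Real.exp_neg, ← hne]
    have : (k : ℝ) ≤ L := by linarith
    calc 16 * (k : ℝ) / n ≤ 16 * L / n := by gcongr
      _ = 16 * (L * (n : ℝ)⁻¹) := by ring

theorem theorem2 (R : Set Plane) (hconv : Convex ℝ R) (hbdd : Bornology.IsBounded R)
    (hint : (interior R).Nonempty) :
    (∀ n : ℕ, Integrable (fun x : Fin n → Plane => (hol (pointSet x) : ℝ)) (uniformPoints R n)) ∧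
    (fun n : ℕ => ∫ x, (hol (pointSet x) : ℝ) ∂(uniformPoints R n))
      =Θ[atTop] (fun n : ℕ => Real.log (n : ℝ) / Real.log (Real.log (n : ℝ))) ∧
    ∃ c C : ℝ, 0 < c ∧ 0 < C ∧
      Tendsto
        (fun n : ℕ => uniformPoints R n
          {x : Fin n → Plane |
            c * (Real.log (n : ℝ) / Real.log (Real.log (n : ℝ))) ≤ (hol (pointSet x) : ℝ) ∧
            (hol (pointSet x) : ℝ) ≤ C * (Real.log (n : ℝ) / Real.log (Real.log (n : ℝ)))})
        atTop (𝓝 1) := by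
  have := isProbabilityMeasure_cond hbdd hint
  have hP (n : ℕ) : IsProbabilityMeasure (uniformPoints R n) := by
    unfold uniformPoints; infer_instance
  have hmeas (n : ℕ) : Measurable fun x : Fin n → Plane => (hol (pointSet x) : ℝ) :=
    measurable_from_nat.comp (measurable_hol_pointSet n)
  have hle (n : ℕ) (x : Fin n → Plane) : (hol (pointSet x) : ℝ) ≤ n := by
    exact_mod_cast hol_pointSet_le x
  have hInt (n : ℕ) :
      Integrable (fun x : Fin n → Plane => (hol (pointSet x) : ℝ)) (uniformPoints R n) :=
    Integrable.of_bound (hmeas n).aestronglyMeasurable n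
      (Eventually.of_forall fun x => by simpa using hle n x)
  obtain ⟨K, hK64, hlow⟩ := exists_uniformPoints_real_hol_lt_le_exp hbdd hint
  set F : ℕ → ℝ := fun n => Real.log (n : ℝ) / Real.log (Real.log (n : ℝ)) with hF
  have hlog : Tendsto (fun n : ℕ => Real.log (n : ℝ)) atTop atTop :=
    Real.tendsto_log_atTop.comp tendsto_natCast_atTop_atTop
  have hev : ∀ᶠ n : ℕ in atTop, K ≤ Real.log (Real.log (n : ℝ)) :=
    (Real.tendsto_log_atTop.comp hlog).eventually_ge_atTop K
  let δ : ℝ → ℝ := fun L => 4 * Real.exp 8 * Real.exp (-(L / 2)) +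
    (Real.exp (16 * (L * Real.exp (-L))) - 1) + 2 * Real.exp (-(3 * L))
  have hδ0 : Tendsto δ atTop (𝓝 0) := by
    have h1 : Tendsto (fun L : ℝ => Real.exp (-(L / 2))) atTop (𝓝 0) :=
      Real.tendsto_exp_neg_atTop_nhds_zero.comp (tendsto_id.atTop_div_const (by norm_num))
    have h2 : Tendsto (fun L : ℝ => Real.exp (-(3 * L))) atTop (𝓝 0) :=
      Real.tendsto_exp_neg_atTop_nhds_zero.comp (tendsto_id.const_mul_atTop (by norm_num))
    have h3 : Tendsto (fun L : ℝ => L * Real.exp (-L)) atTop (𝓝 0) := by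
      simpa using Real.tendsto_pow_mul_exp_neg_atTop_nhds_zero 1
    have h4 : Tendsto (fun L : ℝ => Real.exp (16 * (L * Real.exp (-L)))) atTop (𝓝 1) := by
      have := (Real.continuous_exp.tendsto _).comp (h3.const_mul 16)
      simpa [Function.comp_def] using this
    have := ((h1.const_mul (4 * Real.exp 8)).add (h4.sub_const 1)).add (h2.const_mul 2)
    simpa [δ] using this
  have hδ : Tendsto (fun n : ℕ => δ (Real.log n)) atTop (𝓝 0) := hδ0.comp hlog
  have hgood (n : ℕ) (hn : K ≤ Real.log (Real.log (n : ℝ))) :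
      1 - δ (Real.log n) ≤ (uniformPoints R n).real
        {x | 1 / 20 * F n ≤ (hol (pointSet x) : ℝ) ∧ (hol (pointSet x) : ℝ) ≤ 60 * F n} := by
    have hS : MeasurableSet {x : Fin n → Plane |
        1 / 20 * F n ≤ (hol (pointSet x) : ℝ) ∧ (hol (pointSet x) : ℝ) ≤ 60 * F n} :=
      (measurableSet_le measurable_const (hmeas n)).inter
        (measurableSet_le (hmeas n) measurable_const)
    have hc := probReal_compl_eq_one_sub (μ := uniformPoints R n) hS
    have hsub : {x : Fin n → Plane |
        1 / 20 * F n ≤ (hol (pointSet x) : ℝ) ∧ (hol (pointSet x) : ℝ) ≤ 60 * F n}ᶜ ⊆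
        {x | (hol (pointSet x) : ℝ) < 1 / 20 * F n} ∪ {x | 60 * F n < (hol (pointSet x) : ℝ)} := by
      intro x hx
      by_contra hcon
      rw [Set.mem_union, not_or] at hcon
      exact hx ⟨not_lt.1 hcon.1, not_lt.1 hcon.2⟩
    have h1 := (measureReal_mono (μ := uniformPoints R n) hsub).trans (measureReal_union_le _ _)
    have h2 := hlow n hn
    have h3 := uniformPoints_real_hol_gt_le hconv hbdd hint (hK64.trans hn)
    simp only [δ]
    linarith
  have hFpos (n : ℕ) (hn : K ≤ Real.log (Real.log (n : ℝ))) : 32 ≤ F n := by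
    have h64 := hK64.trans hn
    have hL0 : 0 < Real.log (n : ℝ) := by
      rcases (Real.log_natCast_nonneg n).eq_or_lt with h | h
      · rw [← h, Real.log_zero] at h64; linarith
      · exact h
    have h2 := sq_div_two_le_exp (t := Real.log (Real.log (n : ℝ))) (by linarith)
    rw [Real.exp_log hL0] at h2
    simp only [F]
    rw [le_div_iff₀ (by linarith)]
    nlinarith
  refine ⟨hInt, ⟨?_, ?_⟩, 1 / 20, 60, by norm_num, by norm_num, ?_⟩
  · refine IsBigO.of_bound 61 (hev.mono fun n hn => ?_)
    have hF32 := hFpos n hn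
    have hint0 : 0 ≤ ∫ x, (hol (pointSet x) : ℝ) ∂(uniformPoints R n) :=
      integral_nonneg fun x => Nat.cast_nonneg _
    rw [Real.norm_of_nonneg hint0, Real.norm_of_nonneg (by linarith : 0 ≤ F n)]
    set B := {x : Fin n → Plane | 60 * F n < (hol (pointSet x) : ℝ)} with hB
    have hBm : MeasurableSet B := measurableSet_lt measurable_const (hmeas n)
    have hBi : Integrable (B.indicator (1 : (Fin n → Plane) → ℝ)) (uniformPoints R n) :=
      (integrable_const (1 : ℝ)).indicator hBm
    -- On the exceptional event use the trivial bound `n`; it contributes at most 2, which `F n ≥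
    -- 32` absorbs into the constant 61.
    have h1 : ∫ x, (hol (pointSet x) : ℝ) ∂(uniformPoints R n) ≤
        ∫ x, (60 * F n + n * B.indicator 1 x) ∂(uniformPoints R n) := by
      refine integral_mono (hInt n) ((integrable_const _).add (hBi.const_mul _)) fun x => ?_
      by_cases hx : x ∈ B
      · simp only [Set.indicator_of_mem hx, Pi.one_apply, mul_one]
        linarith [hle n x]
      · simp only [Set.indicator_of_notMem hx, mul_zero, add_zero]
        exact not_lt.1 hx
    rw [integral_add (integrable_const _) (hBi.const_mul _)] at h1
    simp only [integral_const_mul, integral_indicator_one hBm, integral_const, probReal_univ,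
      one_smul] at h1
    have h3 : (uniformPoints R n).real B ≤ 2 * Real.exp (-(3 * Real.log n)) :=
      uniformPoints_real_hol_gt_le hconv hbdd hint (hK64.trans hn)
    have h4 : (n : ℝ) * (2 * Real.exp (-(3 * Real.log n))) ≤ 2 := by
      rcases Nat.eq_zero_or_pos n with h0 | h0
      · simp [h0]
      have hn0 : (0 : ℝ) < n := by exact_mod_cast h0
      have hL : 0 ≤ Real.log (n : ℝ) := Real.log_natCast_nonneg n
      calc (n : ℝ) * (2 * Real.exp (-(3 * Real.log n)))
          = 2 * (Real.exp (Real.log n) * Real.exp (-(3 * Real.log n))) := by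
            rw [Real.exp_log hn0]; ring
        _ = 2 * Real.exp (-(2 * Real.log n)) := by rw [← Real.exp_add]; ring_nf
        _ ≤ 2 * 1 := by
            gcongr
            exact Real.exp_le_one_iff.2 (by linarith)
        _ = 2 := by norm_num
    have h5 := mul_le_mul_of_nonneg_left h3 (Nat.cast_nonneg n : (0 : ℝ) ≤ n)
    linarith
  · have hδ2 : ∀ᶠ n : ℕ in atTop, δ (Real.log n) ≤ 1 / 2 :=
      hδ.eventually_le_const (by norm_num)
    refine IsBigO.of_bound 40 ((hev.and hδ2).mono fun n hn => ?_)
    have hF32 := hFpos n hn.1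
    have hint0 : 0 ≤ ∫ x, (hol (pointSet x) : ℝ) ∂(uniformPoints R n) :=
      integral_nonneg fun x => Nat.cast_nonneg _
    rw [Real.norm_of_nonneg hint0, Real.norm_of_nonneg (by linarith : 0 ≤ F n)]
    -- Markov's inequality at `F n / 20`, an event of probability at least `1 / 2`, gives the
    -- constant 40.
    have h1 := mul_meas_ge_le_integral_of_nonneg (μ := uniformPoints R n)
      (f := fun x => (hol (pointSet x) : ℝ)) (Eventually.of_forall fun x => Nat.cast_nonneg _)
      (hInt n) (1 / 20 * F n)
    have h2 : 1 - δ (Real.log n) ≤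
        (uniformPoints R n).real {x | 1 / 20 * F n ≤ (hol (pointSet x) : ℝ)} :=
      (hgood n hn.1).trans (measureReal_mono fun x hx => hx.1)
    have h3 : 1 / 2 ≤ (uniformPoints R n).real {x | 1 / 20 * F n ≤ (hol (pointSet x) : ℝ)} := by
      linarith [hn.2]
    have h4 : 1 / 20 * F n * (1 / 2) ≤ 1 / 20 * F n *
        (uniformPoints R n).real {x | 1 / 20 * F n ≤ (hol (pointSet x) : ℝ)} := by gcongr
    have h5 : 1 / 20 * F n *
        (uniformPoints R n).real {x | 1 / 20 * F n ≤ (hol (pointSet x) : ℝ)} ≤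
          ∫ x, (hol (pointSet x) : ℝ) ∂(uniformPoints R n) := h1
    linarith
  · have hone : Tendsto (fun n : ℕ => ENNReal.ofReal (1 - δ (Real.log n))) atTop (𝓝 1) := by
      have := ENNReal.tendsto_ofReal (hδ.const_sub 1)
      simpa using this
    refine tendsto_of_tendsto_of_tendsto_of_le_of_le' hone tendsto_const_nhds
      (hev.mono fun n hn => ?_) (Eventually.of_forall fun n => prob_le_one)
    exact (ENNReal.ofReal_le_ofReal (hgood n hn)).trans_eq ofReal_measureReal
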